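/- **Theorem (Computational cost of RSS).** *Setting.* Let $G=(V,E)$ be a finite non-empty simple graph with maximum degree $\Delta$, let $\varepsilon>0$, and let $k\ge 3$ be such that every connected component of $G$ has at least $k$ vertices (for instance $G$ connected and $k\le|V|$). For $j\ge 1$ let $V^{(j)}$ be the set of connected vertex-induced subgraphs of $G$ with $j$ vertices, and let the $j$-state graph $G^{(j)}$ join two of them iff their vertex sets share exactly $j-1$ vertices; $d(H)$ is the degree of $H\in V^{(j)}$ in $G^{(j)}$ (and $d(v)$ the degree of a vertex $v$ of $G$). *Algorithm RSS.* * $\mathrm{UniformSampling}(2)$ returns a uniform edge. For $j\ge 3$, $\mathrm{UniformSampling}(j)$ repeats the following round until it accepts: let $v$ be the output of $\mathrm{DegreePropSampling}(j-1)$, let $u$ be a uniform neighbour of $v$ in $G^{(j-1)}$, let $H\in V^{(j)}$ be the subgraph on the union of the vertices of $u$ and $v$, let $m$ be the number of connected $(j-1)$-subgraphs of $H$; with probability $1/\binom m2$ accept and return $H$. * $\mathrm{DegreePropSampling}(2)$ returns an edge $uv$ with probability proportional to $d(u)+d(v)-2$. For $j\ge 3$, $\mathrm{DegreePropSampling}(j)$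 starts at $v_c=\mathrm{UniformSampling}(j)$ and performs $T_j$ iterations, each of which does nothing with probability $\frac12$, and otherwise draws $v_n=\mathrm{UniformSampling}(j)$ and replaces $v_c$ by $v_n$ with probability $\min\{1,d(v_n)/d(v_c)\}$; it returns $v_c$. RSS is $\mathrm{UniformSampling}(k)$. Let $\pi^{(j)}$ be the distribution on $V^{(j)}$ proportional to $d$. Let $\tau_j(\varepsilon)$ be the mixing time of the idealised chain on $V^{(j)}$, in which proposals are exactly uniform: it moves from $u$ to $v\ne u$ with probability $\frac{1}{2|V^{(j)}|}\min\{1,d(v)/d(u)\}$ and otherwise stays, and $$\tau_j(\varepsilon)=\max_{x}\min\Bigl\{t:\ \tfrac12\sum_y|P^{\ell}(x,y)-\pi^{(j)}_y|\le\varepsilon\ \text{ for all }\ell\ge t\Bigr\}.$$ The loop lengths $T_j$ ($3\le j<k$) are arbitrary natural numbers with $$T_j\le\max\bigl\{\tau_j(\varepsilon),\ \lceil 2j\Delta(\ln j+\ln\Delta+j\ln|V|+\ln\varepsilon^{-1})\rceil\bigr\};$$ in particular $T_j=\tau_j(\varepsilon)$, or the explicit value, may be taken. *Cost.* Each of the following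 costs one step: drawing an edge in a base case, and drawing a random number in $(0,1)$ and comparing it with a threshold. Finding the degree of an element of $V^{(j)}$ costs one step for $j\le 3$ (precomputed tables; preprocessing is not counted) and $j^4\Delta$ steps for $j\ge 4$; drawing a uniform neighbour in $G^{(j)}$ costs one step for $j\le 2$ and $j^4\Delta$ steps for $j\ge3$; forming $H\in V^{(j)}$ and finding $m$ costs $j^3$ steps. Assignments, control flow and returning a result are free. The running time is the expected total number of steps. *Claim.* There is a constant $c>0$ that does not depend on $\varepsilon$, $k$, $G$ or the $T_j$, and for every $\varepsilon>0$ a constant $C>0$ that depends only on $\varepsilon$, such that for all $G$, $k$ as above: 1. $\tau_j(\varepsilon)\le C\,j^2\,\Delta\ln|V|$ for all $3\le j<k$; 2. for $2\le j<k$, if the calls of $\mathrm{DegreePropSampling}(j)$ in $\mathrm{UniformSampling}(j+1)$ are replaced by any sampler whose output has distribution exactly $\pi^{(j)}$, then the output is exactly uniform on $V^{(j+1)}$; 3. for all admissible loop lengths, RSS halts with probability one, and its expected running time is at most $$C\,c^{\,k-3}\,(k!)^2\,((k-1)!)^2\,\Delta^{k-3}\,(\ln|V|)^{k-3}.$$ 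-/

import Mathlib

open scoped ENNReal Nat

noncomputable section

namespace RSS

/-! ## Randomised computations with a step count -/

/-- A randomised computation: `x a n` is the probability that it halts with output `a` after
exactly `n` steps. The total mass may be smaller than `1`; the missing mass is the probability
of never halting. -/
def Run (α : Type*) := α → ℕ → ℝ≥0∞

namespace Run

/-- Never halt. -/
def fail {α : Type*} : Run α := fun _ _ => 0

open Classical in
/-- Return `a`, at no cost. -/
def ret {α : Type*} (a : α) : Run α := fun b n => if b = a ∧ n = 0 then 1 else 0

/-- Sequential composition; the step counts add up. -/
def bind {α β : Type*} (x : Run α) (f : α → Run β) : Run β :=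
  fun b n => ∑' a, ∑ p ∈ Finset.HasAntidiagonal.antidiagonal n, x a p.1 * f a b p.2

/-- Spend `t` steps. -/
def tick (t : ℕ) : Run Unit := fun _ n => if n = t then 1 else 0

/-- Spend one step on drawing a random number in `(0,1)` and testing whether it is smaller
than `p`. -/
def coin (p : ℝ≥0∞) : Run Bool :=
  fun b n => if n = 1 then (if b then min 1 p else 1 - min 1 p) else 0

/-- Draw `a` with probability `w a / ∑ w`, in `t` steps. If there is nothing to draw from
(all weights vanish), the computation does not halt. -/
def draw {α : Type*} [Fintype α] (t : ℕ) (w : α → ℕ) : Run α :=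
  fun a n => if n = t then (w a : ℝ≥0∞) / ∑ b, (w b : ℝ≥0∞) else 0

/-- At most `r` rounds of `body`, which are repeated as long as the result is `none`;
a run that is still going after these rounds is not counted as halting. -/
def rounds {α : Type*} (body : Run (Option α)) : ℕ → Run α
  | 0 => fail
  | r + 1 => body.bind fun o =>
      match o with
      | some a => ret a
      | none => rounds body r

/-- Repeat `body` (with fresh randomness) until it returns `some a`, and return `a`. -/
def untilSome {α : Type*} (body : Run (Option α)) : Run α :=
  fun a n => ⨆ r, rounds body r a n

/-- The probability of halting with output `a`. -/
def law {α : Type*} (x : Run α) (a : α) : ℝ≥0∞ := ∑' n, x a n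

/-- The probability of halting. -/
def haltProb {α : Type*} (x : Run α) : ℝ≥0∞ := ∑' a, x.law a

/-- The expected number of steps of a computation that halts with probability one. -/
def expectedTime {α : Type*} (x : Run α) : ℝ≥0∞ := ∑' a, ∑' n, x a n * (n : ℝ≥0∞)

end Run

/-! ## State graphs -/

variable {V : Type*} [Fintype V] [DecidableEq V] (G : SimpleGraph V) [DecidableRel G.Adj]

/-- The connected `k`-subgraphs of `G`. They are vertex-induced, and are given by their
vertex sets. -/
abbrev State (k : ℕ) := {s : Finset V // s.card = k ∧ (G.induce (s : Set V)).Connected}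

instance (k : ℕ) : Fintype (State G k) := Fintype.ofFinite _

/-- The `k`-state graph: two connected `k`-subgraphs are adjacent iff they share exactly
`k - 1` vertices. -/
def stateGraph (k : ℕ) : SimpleGraph (State G k) where
  Adj H F := (H.1 ∩ F.1).card + 1 = k
  symm := ⟨fun H F h => by rwa [Finset.inter_comm]⟩
  loopless := ⟨fun H h => by rw [Finset.inter_self, H.2.1] at h; omega⟩

instance (k : ℕ) : DecidableRel (stateGraph G k).Adj :=
  fun H F => inferInstanceAs (Decidable ((H.1 ∩ F.1).card + 1 = k))

variable {G} in
/-- The union of two adjacent connected `j`-subgraphs, a connected `(j+1)`-subgraph. -/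
def union {j : ℕ} (hj : 2 ≤ j) (H F : State G j) (h : (stateGraph G j).Adj H F) :
    State G (j + 1) :=
  ⟨H.1 ∪ F.1, by
    have h' : (H.1 ∩ F.1).card + 1 = j := h
    constructor
    · have := Finset.card_union_add_card_inter H.1 F.1
      rw [H.2.1, F.2.1] at this
      omega
    · rw [Finset.coe_union]
      refine SimpleGraph.induce_union_connected H.2.2.preconnected F.2.2.preconnected ?_
      have : (H.1 ∩ F.1).Nonempty := by
        rw [← Finset.card_pos]; omega
      rw [← Finset.coe_inter]
      exact_mod_cast this⟩

/-- The number of connected `j`-subgraphs of a connected `(j+1)`-subgraph `H`. -/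
def numSub {j : ℕ} (H : State G (j + 1)) : ℕ :=
  (Finset.univ.filter fun F : State G j => F.1 ⊆ H.1).card

/-! ## Prices of the operations on states -/

/-- Steps for finding the degree of a state in the `j`-state graph: a look-up for `j ≤ 3`,
and otherwise a scan of the candidates for neighbours, at most `j^2 Δ` of them, with a
connectivity test in `j^2` steps for each. -/
def degreePrice (j : ℕ) : ℕ := if j ≤ 3 then 1 else j ^ 4 * G.maxDegree

/-- Steps for drawing a uniform neighbour of a state in the `j`-state graph: one step for
edges (`j ≤ 2`), and otherwise a scan of the candidates for neighbours. -/
def neighborPrice (j : ℕ) : ℕ := if j ≤ 2 then 1 else j ^ 4 * G.maxDegree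

/-- Steps for forming a `k`-subgraph and counting its connected `(k-1)`-subgraphs:
`k` candidates with a connectivity test in `k^2` steps for each. -/
def countPrice (k : ℕ) : ℕ := k ^ 3

/-! ## The algorithm -/

/-- A uniformly sampled neighbour of `v` in the `j`-state graph. -/
def drawNeighbor {j : ℕ} (v : State G j) : Run {u : State G j // (stateGraph G j).Adj v u} :=
  Run.draw (neighborPrice G j) fun _ => 1

/-- The rejection loop of `UniformSampling`, where `D` samples from the `j`-state graph:
draw `v` by `D`, draw a uniform neighbour `u` of `v`, and accept the union `H` of `u` and `v`
with probability `1 / (m choose 2)`, where `m` is the number of connected `j`-subgraphs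
of `H`; otherwise start again. -/
def rejectionLoop {j : ℕ} (hj : 2 ≤ j) (D : Run (State G j)) : Run (State G (j + 1)) :=
  Run.untilSome <|
    D.bind fun v =>
    (drawNeighbor G v).bind fun u =>
    (Run.tick (countPrice (j + 1))).bind fun _ =>
    (Run.coin ((((numSub G (union hj v u.1 u.2)).choose 2 : ℕ) : ℝ≥0∞)⁻¹)).bind fun b =>
    Run.ret (if b then some (union hj v u.1 u.2) else none)

/-- One iteration of the Metropolis–Hastings loop of `DegreePropSampling` at the state `v`,
with proposals drawn by `U`. -/
def mhStep {j : ℕ} (U : Run (State G j)) (v : State G j) : Run (State G j) :=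
  (Run.coin (1 / 2)).bind fun b =>
    if b then
      U.bind fun w =>
      (Run.tick (degreePrice G j)).bind fun _ =>
      (Run.coin (((stateGraph G j).degree w : ℝ≥0∞) / ((stateGraph G j).degree v : ℝ≥0∞))).bind
        fun a => Run.ret (if a then w else v)
    else Run.ret v

/-- `t` iterations of the Metropolis–Hastings loop from the state `v`. -/
def mhLoop {j : ℕ} (U : Run (State G j)) : ℕ → State G j → Run (State G j)
  | 0, v => Run.ret v
  | t + 1, v => (mhStep G U v).bind fun w => mhLoop U t w

mutual

/-- `UniformSampling`, where `T j` is the number of iterations of the loop in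
`DegreePropSampling` for subgraphs with `j` vertices. -/
def uniformSampling (T : ℕ → ℕ) : (k : ℕ) → Run (State G k)
  | 0 => Run.fail
  | 1 => Run.fail
  | 2 => Run.draw 1 fun _ => 1
  | j + 3 => rejectionLoop G (Nat.le_add_left 2 j) (degreePropSampling T (j + 2))
termination_by k => 2 * k

/-- `DegreePropSampling`; an edge `{u, v}` is drawn from a table, with weight
`d(u) + d(v) - 2`. -/
def degreePropSampling (T : ℕ → ℕ) : (k : ℕ) → Run (State G k)
  | 0 => Run.fail
  | 1 => Run.fail
  | 2 => Run.draw 1 fun e => (∑ v ∈ e.1, G.degree v) - 2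
  | j + 3 =>
      (uniformSampling T (j + 3)).bind fun v =>
      (Run.tick (degreePrice G (j + 3))).bind fun _ =>
      mhLoop G (uniformSampling T (j + 3)) (T (j + 3)) v
termination_by k => 2 * k + 1

end

/-! ## The Metropolis–Hastings chain and its mixing time -/

/-- The transition matrix of the lazy Metropolis–Hastings chain on the complete graph with
vertex set `V^(j)`: uniform proposals, accepted with probability `min {1, d(v) / d(u)}`. -/
def mhMatrix (j : ℕ) : Matrix (State G j) (State G j) ℝ :=
  let p : State G j → State G j → ℝ := fun u v =>
    1 / (2 * Fintype.card (State G j)) *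
      min 1 (((stateGraph G j).degree v : ℝ) / (stateGraph G j).degree u)
  fun u v => if u = v then 1 - ∑ w ∈ Finset.univ.erase u, p u w else p u v

/-- The distribution on `V^(j)` that is proportional to the degree in the `j`-state graph. -/
def degreeDist (j : ℕ) (v : State G j) : ℝ :=
  ((stateGraph G j).degree v : ℝ) / ∑ w, ((stateGraph G j).degree w : ℝ)

/-- Total variation distance between the chain started at `x`, after `l` steps, and the
distribution proportional to the degree. -/
def tvDist (j : ℕ) (x : State G j) (l : ℕ) : ℝ :=
  1 / 2 * ∑ y, |(mhMatrix G j ^ l) x y - degreeDist G j y|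

/-- The mixing time `max_x min {t | the distance is at most ε from time t on}`
(`⊤` if there is no such `t`). -/
def mixingTime (j : ℕ) (ε : ℝ) : ℕ∞ :=
  ⨆ x : State G j, ⨅ (t : ℕ) (_ : ∀ l, t ≤ l → tvDist G j x l ≤ ε), (t : ℕ∞)

/-- The explicit number of steps
`2 j Δ (ln j + ln Δ + j ln |V| + ln (1/ε))`. -/
def explicitSteps (j : ℕ) (ε : ℝ) : ℝ :=
  2 * j * G.maxDegree * (Real.log j + Real.log G.maxDegree + j * Real.log (Fintype.card V)
    + Real.log ε⁻¹)

end RSS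

end

/-!
The three claims rest on elementary facts about the `j`-state graph, for `j < k`. Every state has a
neighbour, because its component has a further vertex and a connected graph has two vertices that
are not cut vertices (`exists_stateGraph_adj`), and it has at most `j ^ 2 Δ` neighbours
(`degree_stateGraph_le`).

*Mixing.* Proposals are uniform, so the chain moves from any state to `y` with probability at least
`π y / (2 j ^ 2 Δ)` (`degreeDist_le_mhMatrix`): no spectral gap is needed, Doeblin's theorem
(`half_sum_abs_pow_sub_le`) gives the distance `(1 - 1 / (2 j ^ 2 Δ)) ^ l` after `l` steps, and so
the mixing time is at most `2 j ^ 2 Δ |ln ε|`, rounded up (`mixingTime_le`).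

*Uniformity.* A sampler with distribution `π`, followed by a uniform neighbour, proposes all ordered
pairs of adjacent states with the same probability. A connected `(j+1)`-subgraph `H` with `m`
connected `j`-subgraphs is the union of exactly `m (m - 1) = 2 (m choose 2)` such pairs, and `m ≥ 2`,
so the acceptance probability `1 / (m choose 2)` makes all `H` equally likely
(`law_some_rejectionRound`, `law_rejectionLoop`).

*Running time.* Whatever the distribution of the sampler, a round accepts with probability at least
`1 / (j + 1 choose 2)`, so Wald's bound (`expectedTime_untilSome_le`) controls the loop for arbitrary
loop lengths. This yields a recursion over the levels in which level `j` contributes a factor of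
order `j ^ 4 Δ ln |V|` (`level_cost_le`). A constant that depends on `ε` would be raised to the power
`k - 3` here. It is avoided since `ln |V| ≥ ln j ≥ |ln ε|` as soon as `j ≥ exp |ln ε|`: the
factor that depends on `ε` is lost only at the finitely many smaller levels (`levelFactor`,
`prod_levelFactor_le`).
-/

noncomputable section

namespace RSS

section

namespace Run

/-! ### Laws and expected running times of randomised computations -/

variable {α β : Type*}

/-- The expectation of `h` on the event that `x` halts. -/
def expect (x : Run α) (h : α → ℕ → ℝ≥0∞) : ℝ≥0∞ := ∑' a, ∑' n, x a n * h a n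

theorem _root_.ENNReal.tsum_antidiagonal (u v w : ℕ → ℝ≥0∞) :
    ∑' n, (∑ p ∈ Finset.HasAntidiagonal.antidiagonal n, u p.1 * v p.2) * w n =
      ∑' m, ∑' l, u m * (v l * w (m + l)) := by
  rw [← ENNReal.tsum_prod (f := fun m l => u m * (v l * w (m + l))),
    ← (Finset.HasAntidiagonal.sigmaAntidiagonalEquivProd (A := ℕ)).tsum_eq, ENNReal.tsum_sigma']
  refine tsum_congr fun n => ?_
  rw [Finset.sum_mul, ← Finset.tsum_subtype]
  refine tsum_congr fun p => ?_
  have := Finset.HasAntidiagonal.mem_antidiagonal.1 p.2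
  simp [this, mul_assoc]

/-- Fubini for sequential composition; all statements about laws, halting and running times of
compositions are instances. -/
theorem expect_bind (x : Run α) (f : α → Run β) (h : β → ℕ → ℝ≥0∞) :
    (x.bind f).expect h = x.expect fun a m => (f a).expect fun b l => h b (m + l) := by
  calc (x.bind f).expect h
      = ∑' b, ∑' n, ∑' a, (∑ p ∈ Finset.HasAntidiagonal.antidiagonal n,
          x a p.1 * f a b p.2) * h b n := by
        simp only [expect, bind, ENNReal.tsum_mul_right]
    _ = ∑' b, ∑' a, ∑' m, ∑' l, x a m * (f a b l * h b (m + l)) := by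
        refine tsum_congr fun b => ?_
        rw [ENNReal.tsum_comm]
        exact tsum_congr fun a => ENNReal.tsum_antidiagonal (x a) (f a b) (h b)
    _ = ∑' a, ∑' b, ∑' m, ∑' l, x a m * (f a b l * h b (m + l)) := ENNReal.tsum_comm
    _ = _ := by
        refine tsum_congr fun a => ?_
        rw [ENNReal.tsum_comm]
        simp only [expect, ENNReal.tsum_mul_left]

theorem haltProb_eq_expect (x : Run α) : x.haltProb = x.expect fun _ _ => 1 := by
  simp [haltProb, law, expect]

open Classical in
theorem law_eq_expect (x : Run α) (a : α) :
    x.law a = x.expect fun b _ => if b = a then 1 else 0 := by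
  rw [expect, tsum_eq_single a (by intro b hb; simp [hb])]
  simp [law]

theorem expectedTime_eq_expect (x : Run α) : x.expectedTime = x.expect fun _ n => n := rfl

theorem expect_const (x : Run α) (h : α → ℝ≥0∞) :
    (x.expect fun a _ => h a) = ∑' a, x.law a * h a := by
  simp only [expect, law, ENNReal.tsum_mul_right]

theorem law_bind (x : Run α) (f : α → Run β) (b : β) :
    (x.bind f).law b = ∑' a, x.law a * (f a).law b := by
  rw [law_eq_expect, expect_bind]
  simp only [← law_eq_expect]
  exact expect_const x fun a => (f a).law b

theorem haltProb_bind (x : Run α) (f : α → Run β) :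
    (x.bind f).haltProb = ∑' a, x.law a * (f a).haltProb := by
  rw [haltProb_eq_expect, expect_bind]
  simp only [← haltProb_eq_expect]
  exact expect_const x fun a => (f a).haltProb

theorem haltProb_bind_eq_one {x : Run α} {f : α → Run β} (hx : x.haltProb = 1)
    (hf : ∀ a, (f a).haltProb = 1) : (x.bind f).haltProb = 1 := by
  simp only [haltProb_bind, hf, mul_one]
  exact hx

theorem expectedTime_bind (x : Run α) (f : α → Run β) (hf : ∀ a, (f a).haltProb = 1) :
    (x.bind f).expectedTime = x.expectedTime + ∑' a, x.law a * (f a).expectedTime := by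
  rw [expectedTime_eq_expect, expect_bind, ← expect_const, expectedTime_eq_expect]
  simp only [expect, ← ENNReal.tsum_add, ← mul_add]
  refine tsum_congr fun a => tsum_congr fun m => ?_
  congr 1
  have h1 : ∑' b, ∑' l, f a b l = 1 := hf a
  simp only [Nat.cast_add, mul_add, ENNReal.tsum_add, ENNReal.tsum_mul_right, h1, one_mul]
  rfl

theorem expectedTime_bind_le {x : Run α} {f : α → Run β} {t : ℝ≥0∞} (hx : x.haltProb = 1)
    (hf : ∀ a, (f a).haltProb = 1) (ht : ∀ a, (f a).expectedTime ≤ t) :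
    (x.bind f).expectedTime ≤ x.expectedTime + t := by
  rw [expectedTime_bind x f hf]
  gcongr
  calc ∑' a, x.law a * (f a).expectedTime ≤ ∑' a, x.law a * t := by gcongr; exact ht _
    _ = t := by rw [ENNReal.tsum_mul_right]; exact (congrArg (· * t) hx).trans (one_mul t)

open Classical in
theorem law_ret (a b : α) : (ret a).law b = if b = a then 1 else 0 := by
  by_cases h : b = a <;> simp [law, ret, h]

@[simp] theorem haltProb_ret (a : α) : (ret a).haltProb = 1 := by
  classical simp [haltProb, law_ret]

@[simp] theorem expectedTime_ret (a : α) : (ret a).expectedTime = 0 := by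
  classical
  simp only [expectedTime, ret, ENNReal.tsum_eq_zero]
  intro b n
  by_cases h : n = 0 <;> simp [h]

theorem law_tick (t : ℕ) (u : Unit) : (tick t).law u = 1 := by simp [law, tick]

@[simp] theorem haltProb_tick (t : ℕ) : (tick t).haltProb = 1 := by simp [haltProb, law_tick]

@[simp] theorem expectedTime_tick (t : ℕ) : (tick t).expectedTime = t := by
  simp [expectedTime, tick]

theorem law_coin (p : ℝ≥0∞) (b : Bool) :
    (coin p).law b = if b then min 1 p else 1 - min 1 p := by
  simp only [law, coin, tsum_ite_eq]

@[simp] theorem haltProb_coin (p : ℝ≥0∞) : (coin p).haltProb = 1 := by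
  simp [haltProb, law_coin]

@[simp] theorem expectedTime_coin (p : ℝ≥0∞) : (coin p).expectedTime = 1 := by
  have h := haltProb_coin p
  rw [← h]
  simp [expectedTime, coin, haltProb, law]

theorem law_draw [Fintype α] (t : ℕ) (w : α → ℕ) (a : α) :
    (draw t w).law a = (w a : ℝ≥0∞) / ∑ b, (w b : ℝ≥0∞) := by
  simp only [law, draw, tsum_ite_eq]

theorem haltProb_draw [Fintype α] (t : ℕ) {w : α → ℕ} {a : α} (ha : w a ≠ 0) :
    (draw t w).haltProb = 1 := by
  simp only [haltProb, law_draw, tsum_fintype, div_eq_mul_inv, ← Finset.sum_mul]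
  refine ENNReal.mul_inv_cancel ?_ ?_
  · simpa using ⟨a, ha⟩
  · exact ENNReal.sum_ne_top.2 fun _ _ => ENNReal.natCast_ne_top _

theorem expectedTime_draw [Fintype α] (t : ℕ) {w : α → ℕ} {a : α} (ha : w a ≠ 0) :
    (draw t w).expectedTime = t := by
  have h := haltProb_draw t ha
  have : (draw t w).expectedTime = (draw t w).haltProb * t := by
    simp only [expectedTime, haltProb, law, ← ENNReal.tsum_mul_right]
    refine tsum_congr fun b => tsum_congr fun n => ?_
    by_cases hn : n = t <;> simp [draw, hn]
  rw [this, h, one_mul]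

/-! ### Repetition until acceptance -/

theorem rounds_succ (body : Run (Option α)) (r : ℕ) :
    rounds body (r + 1) = body.bind fun o => o.elim (rounds body r) ret := by
  rw [rounds]
  congr 1
  funext o
  cases o <;> rfl

theorem rounds_mono (body : Run (Option α)) : Monotone (fun r a n => rounds body r a n) := by
  refine monotone_nat_of_le_succ fun r => ?_
  induction r with
  | zero => intro a n; exact zero_le
  | succ r ih =>
    rw [rounds_succ body r, rounds_succ body (r + 1)]
    intro a n
    refine ENNReal.tsum_le_tsum fun o => Finset.sum_le_sum fun p _ => ?_
    gcongr
    cases o with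
    | none => exact ih a p.2
    | some b => exact le_rfl

/-- Monotone convergence for sums. -/
theorem _root_.ENNReal.tsum_iSup_of_monotone {ι : Type*} {f : ℕ → ι → ℝ≥0∞} (hf : Monotone f) :
    ∑' i, ⨆ r, f r i = ⨆ r, ∑' i, f r i := by
  simp only [ENNReal.tsum_eq_iSup_sum]
  rw [iSup_comm]
  refine iSup_congr fun s => ?_
  exact ENNReal.finsetSum_iSup_of_monotone fun i _ _ h => hf h i

theorem expect_untilSome (body : Run (Option α)) (h : α → ℕ → ℝ≥0∞) :
    (untilSome body).expect h = ⨆ r, (rounds body r).expect h := by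
  simp only [expect, untilSome, ENNReal.iSup_mul]
  have hm : ∀ a n, Monotone fun r => rounds body r a n * h a n := fun a n r s hrs => by
    dsimp only
    gcongr
    exact rounds_mono body hrs a n
  rw [← ENNReal.tsum_iSup_of_monotone]
  · refine tsum_congr fun a => ?_
    exact ENNReal.tsum_iSup_of_monotone fun r s hrs n => hm a n hrs
  · exact fun r s hrs a => ENNReal.tsum_le_tsum fun n => hm a n hrs

theorem _root_.ENNReal.tsum_option (f : Option α → ℝ≥0∞) :
    ∑' o, f o = f none + ∑' a, f (some a) := by
  rw [← (Equiv.optionEquivSumPUnit.{0} α).symm.tsum_eq,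
    ENNReal.summable.tsum_sum ENNReal.summable]
  simp [add_comm]

/-- To halt with `a` within `r` rounds is to fail `i < r` times and then to accept with `a`. -/
theorem law_rounds (body : Run (Option α)) (r : ℕ) (a : α) :
    (rounds body r).law a = (∑ i ∈ Finset.range r, body.law none ^ i) * body.law (some a) := by
  classical
  induction r with
  | zero => simp [law, rounds, fail]
  | succ r ih =>
    have h : ∑' b, body.law (some b) * (ret b).law a = body.law (some a) := by
      rw [tsum_eq_single a (by intro b hb; simp [law_ret, hb.symm])]
      simp [law_ret]
    rw [rounds_succ, law_bind, ENNReal.tsum_option]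
    simp only [Option.elim]
    rw [h, ih, Finset.sum_range_succ', add_mul, pow_zero, one_mul, ← mul_assoc, Finset.mul_sum]
    simp only [pow_succ']

theorem law_untilSome (body : Run (Option α)) (a : α) :
    (untilSome body).law a = (1 - body.law none)⁻¹ * body.law (some a) := by
  classical
  rw [law_eq_expect, expect_untilSome]
  simp only [← law_eq_expect, law_rounds]
  rw [← ENNReal.iSup_mul, ← ENNReal.tsum_geometric, ENNReal.tsum_eq_iSup_nat]

theorem law_none_add (body : Run (Option α)) (hb : body.haltProb = 1) :
    body.law none + ∑' a, body.law (some a) = 1 := by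
  rw [← hb, haltProb, ENNReal.tsum_option]

theorem haltProb_untilSome {body : Run (Option α)} (hb : body.haltProb = 1)
    (hn : body.law none < 1) : (untilSome body).haltProb = 1 := by
  have h := law_none_add body hb
  have hs : ∑' a, body.law (some a) = 1 - body.law none :=
    ENNReal.eq_sub_of_add_eq hn.ne_top (by rw [add_comm, h])
  simp only [haltProb, law_untilSome]
  rw [ENNReal.tsum_mul_left, hs]
  exact ENNReal.inv_mul_cancel (tsub_pos_of_lt hn).ne' (by finiteness)

theorem haltProb_rounds_le {body : Run (Option α)} (hb : body.haltProb = 1) (r : ℕ) :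
    (rounds body r).haltProb ≤ 1 := by
  induction r with
  | zero => simp [haltProb, law, rounds, fail]
  | succ r ih =>
    rw [rounds_succ, haltProb_bind, ← hb, haltProb]
    refine ENNReal.tsum_le_tsum fun o => ?_
    cases o
    · exact mul_le_of_le_one_right zero_le ih
    · simp

theorem expectedTime_bind_le_of_haltProb_le (x : Run α) (f : α → Run β)
    (hf : ∀ a, (f a).haltProb ≤ 1) :
    (x.bind f).expectedTime ≤ x.expectedTime + ∑' a, x.law a * (f a).expectedTime := by
  rw [expectedTime_eq_expect, expect_bind, ← expect_const, expectedTime_eq_expect]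
  simp only [expect, ← ENNReal.tsum_add, ← mul_add]
  refine ENNReal.tsum_le_tsum fun a => ENNReal.tsum_le_tsum fun m => ?_
  gcongr
  have h1 : ∑' b, ∑' l, f a b l ≤ 1 := hf a
  simp only [Nat.cast_add, mul_add, ENNReal.tsum_add, ENNReal.tsum_mul_right]
  gcongr
  · exact mul_le_of_le_one_left zero_le h1
  · exact le_rfl

/-- Wald's bound for a loop whose rounds are accepted with probability at least `p`. -/
theorem expectedTime_untilSome_le {body : Run (Option α)} {p : ℝ≥0∞} (hb : body.haltProb = 1)
    (hp0 : p ≠ 0) (hp1 : p ≤ 1) (hn : body.law none ≤ 1 - p) :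
    (untilSome body).expectedTime ≤ p⁻¹ * body.expectedTime := by
  rw [expectedTime_eq_expect, expect_untilSome]
  refine iSup_le fun r => ?_
  rw [← expectedTime_eq_expect]
  induction r with
  | zero => simp [expectedTime, rounds, fail]
  | succ r ih =>
    rw [rounds_succ]
    refine (expectedTime_bind_le_of_haltProb_le _ _ ?_).trans ?_
    · rintro (_ | a)
      · exact haltProb_rounds_le hb r
      · simp
    · rw [ENNReal.tsum_option]
      simp only [Option.elim, expectedTime_ret, mul_zero, tsum_zero, add_zero]
      calc body.expectedTime + body.law none * (rounds body r).expectedTime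
          ≤ body.expectedTime + (1 - p) * (p⁻¹ * body.expectedTime) := by gcongr
        _ = (p + (1 - p)) * (p⁻¹ * body.expectedTime) := by
          rw [add_mul, ← mul_assoc p, ENNReal.mul_inv_cancel hp0 (hp1.trans_lt ENNReal.one_lt_top).ne, one_mul]
        _ = _ := by rw [add_tsub_cancel_of_le hp1, one_mul]

end Run
end

section
variable {V : Type*} [Fintype V] [DecidableEq V] {G : SimpleGraph V}

/-! ### Connected subgraphs and the state graph -/

/-- A connected graph with at least two vertices has two vertices that are not cut vertices: the
leaves of a spanning tree. -/
theorem exists_ne_connected_erase {s : Finset V} (hs : (G.induce (s : Set V)).Connected)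
    (h2 : 2 ≤ s.card) :
    ∃ a ∈ s, ∃ b ∈ s, a ≠ b ∧ (G.induce ((s.erase a : Finset V) : Set V)).Connected ∧
      (G.induce ((s.erase b : Finset V) : Set V)).Connected := by
  classical
  have : Nontrivial (s : Set V) := by
    rw [Set.nontrivial_coe_sort]
    exact Finset.one_lt_card_iff_nontrivial.1 h2
  have key : ∀ a : (s : Set V), ((G.induce (s : Set V)).induce {a}ᶜ).Connected →
      (G.induce ((s.erase a : Finset V) : Set V)).Connected := by
    intro a h
    refine h.map (⟨fun x => ⟨x.1.1, ?_⟩, fun {x y} hxy => hxy⟩ :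
      (G.induce (s : Set V)).induce {a}ᶜ →g G.induce ((s.erase a : Finset V) : Set V)) ?_
    · have h1 := x.2
      have h3 := x.1.2
      simp only [Finset.coe_erase, Set.mem_sdiff, Set.mem_singleton_iff]
      exact ⟨h3, fun h => h1 (Subtype.ext h)⟩
    · rintro ⟨y, hy⟩
      rw [Finset.mem_coe, Finset.mem_erase] at hy
      exact ⟨⟨⟨y, hy.2⟩, fun h => hy.1 (congrArg Subtype.val h)⟩, rfl⟩
  obtain ⟨T, hTle, hT⟩ := hs.exists_isTree_le
  obtain ⟨a, b, hab, ha, hb⟩ := hT.exists_ne_and_degree_eq_one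
  refine ⟨a, a.2, b, b.2, fun h => hab (Subtype.ext h), key a ?_, key b ?_⟩
  · exact (hT.connected.induce_compl_singleton_of_degree_eq_one ha).mono fun _ _ h => hTle h
  · exact (hT.connected.induce_compl_singleton_of_degree_eq_one hb).mono fun _ _ h => hTle h

omit [DecidableEq V] in
theorem exists_adj_not_mem {k : ℕ} (hK : ∀ K : G.ConnectedComponent, k ≤ K.supp.ncard) {j : ℕ}
    (hj : 1 ≤ j) (hjk : j < k) (H : State G j) : ∃ a ∈ H.1, ∃ b ∉ H.1, G.Adj a b := by
  obtain ⟨v, hv⟩ : H.1.Nonempty := by rw [← Finset.card_pos, H.2.1]; omega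
  obtain ⟨w, hw, hwH⟩ : ∃ w ∈ (G.connectedComponentMk v).supp, w ∉ (H.1 : Set V) := by
    by_contra! h
    have h1 := Set.ncard_le_ncard (t := (H.1 : Set V)) h (Set.toFinite _)
    have h2 := hK (G.connectedComponentMk v)
    rw [Set.ncard_coe_finset, H.2.1] at h1
    omega
  rw [SimpleGraph.ConnectedComponent.mem_supp_iff, SimpleGraph.ConnectedComponent.eq] at hw
  obtain ⟨p⟩ := hw.symm
  obtain ⟨d, -, h1, h2⟩ := p.exists_boundary_dart (H.1 : Set V) hv hwH
  exact ⟨d.fst, h1, d.snd, h2, d.adj⟩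

/-- A connected subgraph together with an outer neighbour. -/
def insertState {j : ℕ} (H : State G j) {a b : V} (ha : a ∈ H.1) (hb : b ∉ H.1)
    (hab : G.Adj a b) : State G (j + 1) :=
  ⟨insert b H.1, by
    constructor
    · rw [Finset.card_insert_of_notMem hb, H.2.1]
    · have h := SimpleGraph.induce_union_connected H.2.2.preconnected
        (G.induce_pair_connected_of_adj hab).preconnected ⟨a, ha, by simp⟩
      have e : (H.1 : Set V) ∪ {a, b} = ((insert b H.1 : Finset V) : Set V) := by
        ext x
        simp only [Set.mem_union, Finset.mem_coe, Set.mem_insert_iff, Set.mem_singleton_iff,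
          Finset.coe_insert]
        constructor
        · rintro (h | rfl | rfl)
          · exact Or.inr h
          · exact Or.inr ha
          · exact Or.inl rfl
        · rintro (h | h)
          · exact Or.inr (Or.inr h)
          · exact Or.inl h
      rwa [e] at h⟩

theorem nonempty_state [Nonempty V] {k : ℕ} (hK : ∀ K : G.ConnectedComponent, k ≤ K.supp.ncard)
    {j : ℕ} (hj : 1 ≤ j) (hjk : j ≤ k) : Nonempty (State G j) := by
  induction j, hj using Nat.le_induction with
  | base =>
    obtain ⟨v⟩ := ‹Nonempty V›
    refine ⟨⟨{v}, by simp, ?_⟩⟩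
    rw [Finset.coe_singleton]
    have : Subsingleton ({v} : Set V) := by infer_instance
    exact ⟨SimpleGraph.Preconnected.of_subsingleton⟩
  | succ j hj ih =>
    obtain ⟨H⟩ := ih (by omega)
    obtain ⟨a, ha, b, hb, hab⟩ := exists_adj_not_mem hK hj (by omega) H
    exact ⟨insertState H ha hb hab⟩

/-- Add an outer neighbour `b` to `H` and remove from the result a vertex other than `b` that is not
a cut vertex. -/
theorem exists_stateGraph_adj {k : ℕ} (hK : ∀ K : G.ConnectedComponent, k ≤ K.supp.ncard)
    {j : ℕ} (hj : 1 ≤ j) (hjk : j < k) (H : State G j) : ∃ F, (stateGraph G j).Adj H F := by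
  obtain ⟨a, ha, b, hb, hab⟩ := exists_adj_not_mem hK hj hjk H
  set I := insertState H ha hb hab with hI
  have hI1 : I.1 = insert b H.1 := rfl
  obtain ⟨c, hc, hcb, hcon⟩ : ∃ c ∈ I.1, c ≠ b ∧
      (G.induce ((I.1.erase c : Finset V) : Set V)).Connected := by
    obtain ⟨c, hc, d, hd, hcd, h1, h2⟩ := exists_ne_connected_erase I.2.2 (by rw [I.2.1]; omega)
    by_cases h : c = b
    · exact ⟨d, hd, fun h' => hcd (h.trans h'.symm), h2⟩
    · exact ⟨c, hc, h, h1⟩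
  have hcH : c ∈ H.1 := by
    rw [hI1, Finset.mem_insert] at hc
    exact hc.resolve_left hcb
  refine ⟨⟨I.1.erase c, by rw [Finset.card_erase_of_mem hc, I.2.1]; rfl, hcon⟩, ?_⟩
  change (H.1 ∩ I.1.erase c).card + 1 = j
  have : H.1 ∩ I.1.erase c = H.1.erase c := by
    ext x
    simp only [hI1, Finset.mem_inter, Finset.mem_erase, Finset.mem_insert]
    tauto
  rw [this, Finset.card_erase_of_mem hcH, H.2.1]
  omega

theorem degree_stateGraph_pos {k : ℕ} (hK : ∀ K : G.ConnectedComponent, k ≤ K.supp.ncard)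
    {j : ℕ} (hj : 1 ≤ j) (hjk : j < k) (H : State G j) : 0 < (stateGraph G j).degree H :=
  (SimpleGraph.degree_pos_iff_exists_adj _ _).2 (exists_stateGraph_adj hK hj hjk H)

/-- A neighbour of `H` arises by exchanging one of the `j` vertices of `H` for one of its at most
`j Δ` outer neighbours. -/
theorem degree_stateGraph_le [DecidableRel G.Adj] {j : ℕ} (hj : 2 ≤ j) (H : State G j) :
    (stateGraph G j).degree H ≤ j ^ 2 * G.maxDegree := by
  have hsub : ((stateGraph G j).neighborFinset H).image Subtype.val ⊆
      (H.1 ×ˢ H.1.biUnion fun x => G.neighborFinset x).image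
        fun p => insert p.2 (H.1.erase p.1) := by
    intro S hS
    obtain ⟨F, hF, rfl⟩ := Finset.mem_image.1 hS
    rw [SimpleGraph.mem_neighborFinset] at hF
    have hF' : (H.1 ∩ F.1).card + 1 = j := hF
    have h1 := Finset.card_sdiff_add_card_inter H.1 F.1
    have h2 := Finset.card_sdiff_add_card_inter F.1 H.1
    rw [Finset.inter_comm, F.2.1] at h2
    rw [H.2.1] at h1
    obtain ⟨a, ha⟩ := Finset.card_eq_one.1 (show (H.1 \ F.1).card = 1 by omega)
    obtain ⟨b, hb⟩ := Finset.card_eq_one.1 (show (F.1 \ H.1).card = 1 by omega)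
    have ha' : ∀ x, (x ∈ H.1 ∧ x ∉ F.1) ↔ x = a := fun x => by
      rw [← Finset.mem_sdiff, ha, Finset.mem_singleton]
    have hb' : ∀ x, (x ∈ F.1 ∧ x ∉ H.1) ↔ x = b := fun x => by
      rw [← Finset.mem_sdiff, hb, Finset.mem_singleton]
    have hbF := ((hb' b).2 rfl).1
    have : Nontrivial (F.1 : Set V) := by
      rw [Set.nontrivial_coe_sort]
      refine Finset.one_lt_card_iff_nontrivial.1 ?_
      rw [F.2.1]; omega
    obtain ⟨x, hx⟩ := F.2.2.preconnected.exists_adj_of_nontrivial ⟨b, hbF⟩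
    have hx' : G.Adj b x.1 := hx
    have hxH : x.1 ∈ H.1 := by
      by_contra h
      have := (hb' x.1).1 ⟨x.2, h⟩
      exact hx'.ne this.symm
    refine Finset.mem_image.2 ⟨(a, b), ?_, ?_⟩
    · rw [Finset.mem_product, Finset.mem_biUnion]
      exact ⟨((ha' a).2 rfl).1, x.1, hxH, by simpa using hx'.symm⟩
    · ext y
      simp only [Finset.mem_insert, Finset.mem_erase, ← ha', ← hb', ne_eq]
      tauto
  have hcard := Finset.card_le_card hsub
  rw [Finset.card_image_of_injective _ Subtype.val_injective,
    SimpleGraph.card_neighborFinset_eq_degree] at hcard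
  refine hcard.trans (Finset.card_image_le.trans ?_)
  rw [Finset.card_product, H.2.1, sq, mul_assoc]
  gcongr
  have := Finset.card_biUnion_le_card_mul H.1 (fun x => G.neighborFinset x) G.maxDegree
    (fun x _ => by simpa using G.degree_le_maxDegree x)
  rwa [H.2.1] at this

theorem two_le_numSub {j : ℕ} (hj : 1 ≤ j) (H : State G (j + 1)) : 2 ≤ numSub G H := by
  obtain ⟨a, ha, b, hb, hab, h1, h2⟩ := exists_ne_connected_erase H.2.2 (by rw [H.2.1]; omega)
  refine Finset.one_lt_card.2
    ⟨⟨H.1.erase a, by rw [Finset.card_erase_of_mem ha, H.2.1]; rfl, h1⟩, ?_,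
     ⟨H.1.erase b, by rw [Finset.card_erase_of_mem hb, H.2.1]; rfl, h2⟩, ?_, ?_⟩
  · simpa using Finset.erase_subset _ _
  · simpa using Finset.erase_subset _ _
  · intro h
    have h := congrArg Subtype.val h
    dsimp only at h
    have : a ∈ H.1.erase b := Finset.mem_erase.2 ⟨hab, ha⟩
    rw [← h] at this
    simp at this

theorem numSub_le {j : ℕ} (H : State G (j + 1)) : numSub G H ≤ j + 1 := by
  rw [numSub, ← Finset.card_image_of_injective _ Subtype.val_injective]
  calc _ ≤ (H.1.powersetCard j).card := Finset.card_le_card ?_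
    _ = j + 1 := by rw [Finset.card_powersetCard, H.2.1, Nat.choose_succ_self_right]
  intro S hS
  obtain ⟨F, hF, rfl⟩ := Finset.mem_image.1 hS
  rw [Finset.mem_powersetCard]
  exact ⟨by simpa using hF, F.2.1⟩

omit [Fintype V] in
/-- Two different `j`-subsets of a set with `j + 1` elements are adjacent and span it. -/
theorem adj_and_union_eq_iff {j : ℕ} (hj : 2 ≤ j) (H : State G (j + 1)) (v u : State G j) :
    (∃ h : (stateGraph G j).Adj v u, union hj v u h = H) ↔ (v.1 ⊆ H.1 ∧ u.1 ⊆ H.1) ∧ v ≠ u := by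
  constructor
  · rintro ⟨h, rfl⟩
    exact ⟨⟨Finset.subset_union_left, Finset.subset_union_right⟩, h.ne⟩
  · rintro ⟨⟨h1, h2⟩, hne⟩
    have hle := Finset.card_le_card (Finset.union_subset h1 h2)
    have hadd := Finset.card_union_add_card_inter v.1 u.1
    rw [v.2.1, u.2.1] at hadd
    rw [H.2.1] at hle
    have hlt : (v.1 ∩ u.1).card < j := by
      refine lt_of_lt_of_eq ?_ v.2.1
      refine Finset.card_lt_card ⟨Finset.inter_subset_left, fun h => hne (Subtype.ext ?_)⟩
      refine Finset.eq_of_subset_of_card_le (h.trans Finset.inter_subset_right) ?_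
      rw [v.2.1, u.2.1]
    refine ⟨(by omega : (v.1 ∩ u.1).card + 1 = j), Subtype.ext ?_⟩
    refine Finset.eq_of_subset_of_card_le (Finset.union_subset h1 h2) ?_
    rw [H.2.1]
    change j + 1 ≤ (v.1 ∪ u.1).card
    omega

/-- The number of ordered pairs of different connected `j`-subgraphs of `H`. -/
theorem card_pairs {j : ℕ} (H : State G (j + 1)) :
    ∑ v : State G j, ∑ u : State G j, (if (v.1 ⊆ H.1 ∧ u.1 ⊆ H.1) ∧ v ≠ u then 1 else 0) =
      2 * (numSub G H).choose 2 := by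
  have e : (numSub G H).choose 2 * 2 = numSub G H * (numSub G H - 1) := by
    rw [Nat.choose_two_right, Nat.div_mul_cancel (Nat.even_mul_pred_self _).two_dvd]
  rw [mul_comm, e, Nat.mul_sub_one, numSub, ← Finset.offDiag_card, ← Finset.sum_product',
    ← Finset.card_filter]
  congr 1
  ext p
  simp [Finset.mem_offDiag, and_assoc]

end

section

/-! ### Mixing of the Metropolis–Hastings chain -/

/-- One step of a chain that dominates `δ π` in every row contracts the distance to its stationary
distribution `π` by `1 - δ`. -/
theorem sum_abs_mulStep_le {S : Type*} [Fintype S] {P : Matrix S S ℝ} {π : S → ℝ} {δ : ℝ}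
    (hP : ∀ x, ∑ y, P x y = 1) (hπ : ∑ x, π x = 1) (hst : ∀ y, ∑ x, π x * P x y = π y)
    (hδ : ∀ x y, δ * π y ≤ P x y) (μ : S → ℝ) (hμ : ∑ x, μ x = 1) :
    ∑ y, |∑ z, μ z * P z y - π y| ≤ (1 - δ) * ∑ y, |μ y - π y| := by
  -- The correction `δ π y` does not change the sum, as `μ - π` has total mass `0`.
  have e : ∀ y, ∑ z, μ z * P z y - π y = ∑ z, (μ z - π z) * (P z y - δ * π y) := by
    intro y
    simp only [sub_mul, mul_sub, Finset.sum_sub_distrib, ← Finset.sum_mul, hμ, hπ, hst]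
    ring
  calc ∑ y, |∑ z, μ z * P z y - π y|
      ≤ ∑ y, ∑ z, |μ z - π z| * (P z y - δ * π y) := by
        refine Finset.sum_le_sum fun y _ => ?_
        rw [e]
        refine (Finset.abs_sum_le_sum_abs _ _).trans_eq (Finset.sum_congr rfl fun z _ => ?_)
        rw [abs_mul, abs_of_nonneg (sub_nonneg.2 (hδ z y))]
    _ = ∑ z, |μ z - π z| * (1 - δ) := by
        rw [Finset.sum_comm]
        refine Finset.sum_congr rfl fun z _ => ?_
        rw [← Finset.mul_sum, Finset.sum_sub_distrib, ← Finset.mul_sum, hP, hπ, mul_one]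
    _ = _ := by rw [← Finset.sum_mul, mul_comm]

/-- **Doeblin's theorem** for finite chains: if all rows of `P` dominate `δ π`, then the total
variation distance to `π` is at most `(1 - δ) ^ l` after `l` steps. -/
theorem half_sum_abs_pow_sub_le {S : Type*} [Fintype S] [DecidableEq S] {P : Matrix S S ℝ}
    {π : S → ℝ} {δ : ℝ} (hP : ∀ x, ∑ y, P x y = 1) (hπ : ∑ x, π x = 1) (hπ0 : ∀ x, 0 ≤ π x)
    (hst : ∀ y, ∑ x, π x * P x y = π y) (hδ : ∀ x y, δ * π y ≤ P x y) (hδ1 : δ ≤ 1) (x : S)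
    (l : ℕ) : 1 / 2 * ∑ y, |(P ^ l) x y - π y| ≤ (1 - δ) ^ l := by
  have hrow : ∀ l, ∑ y, (P ^ l) x y = 1 := by
    intro l
    induction l with
    | zero => simp [Matrix.one_apply]
    | succ l ih =>
      simp only [pow_succ, Matrix.mul_apply]
      rw [Finset.sum_comm]
      simp only [← Finset.mul_sum, hP, mul_one, ih]
  induction l with
  | zero =>
    have : ∑ y, |(P ^ 0) x y - π y| ≤ ∑ y, ((P ^ 0) x y + π y) := by
      refine Finset.sum_le_sum fun y _ => ?_
      refine (abs_sub _ _).trans_eq ?_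
      rw [abs_of_nonneg (hπ0 y), abs_of_nonneg]
      rw [pow_zero, Matrix.one_apply]
      split_ifs <;> norm_num
    rw [Finset.sum_add_distrib, hrow, hπ] at this
    rw [pow_zero (1 - δ)]
    linarith
  | succ l ih =>
    have h := sum_abs_mulStep_le hP hπ hst hδ ((P ^ l) x) (hrow l)
    simp only [pow_succ P, Matrix.mul_apply]
    rw [pow_succ']
    have := mul_le_mul_of_nonneg_left ih (sub_nonneg.2 hδ1)
    linarith

variable {V : Type*} [Fintype V] [DecidableEq V] {G : SimpleGraph V}

theorem mhMatrix_sum (j : ℕ) (x : State G j) : ∑ y, mhMatrix G j x y = 1 := by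
  rw [← Finset.add_sum_erase _ _ (Finset.mem_univ x)]
  simp only [mhMatrix, if_true]
  rw [sub_add_eq_add_sub, sub_eq_iff_eq_add]
  congr 1
  refine Finset.sum_congr rfl fun y hy => ?_
  rw [if_neg (Finset.ne_of_mem_erase hy).symm]

theorem mhMatrix_reversible {j : ℕ} (hd : ∀ H : State G j, 0 < (stateGraph G j).degree H)
    (x y : State G j) :
    degreeDist G j x * mhMatrix G j x y = degreeDist G j y * mhMatrix G j y x := by
  by_cases h : x = y
  · rw [h]
  have key : ∀ a b : ℝ, 0 < a → a * min 1 (b / a) = min a b := fun a b ha => by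
    rw [mul_min_of_nonneg _ _ ha.le, mul_one, mul_div_cancel₀ _ ha.ne']
  have hx : (0 : ℝ) < (stateGraph G j).degree x := by exact_mod_cast hd x
  have hy : (0 : ℝ) < (stateGraph G j).degree y := by exact_mod_cast hd y
  simp only [mhMatrix, degreeDist, if_neg h, if_neg (Ne.symm h)]
  have h1 := key _ ((stateGraph G j).degree y : ℝ) hx
  have h2 := (key _ ((stateGraph G j).degree x : ℝ) hy).trans (min_comm _ _)
  have h3 : ∀ a s n m : ℝ, a / s * (n * m) = n / s * (a * m) := fun a s n m => by ring
  rw [h3, h1, h3 ((stateGraph G j).degree y : ℝ), h2]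

theorem degreeDist_nonneg (j : ℕ) (x : State G j) : 0 ≤ degreeDist G j x := by
  unfold degreeDist; positivity

theorem sum_degreeDist {j : ℕ} (hd : ∀ H : State G j, 0 < (stateGraph G j).degree H)
    [Nonempty (State G j)] : ∑ x, degreeDist G j x = 1 := by
  simp only [degreeDist, ← Finset.sum_div]
  refine div_self (Finset.sum_pos (fun x _ => ?_) Finset.univ_nonempty).ne'
  exact_mod_cast hd x

/-- If all degrees lie between `1` and `B`, the chain moves to `y` with probability at least
`π y / (2 B)`, whatever the present state: a proposal is accepted with probability at least
`d y / B`, and the average degree is at least `1`. -/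
theorem degreeDist_le_mhMatrix {j : ℕ} (hd : ∀ H : State G j, 0 < (stateGraph G j).degree H)
    {B : ℝ} (hB : ∀ H : State G j, ((stateGraph G j).degree H : ℝ) ≤ B) (x y : State G j) :
    1 / (2 * B) * degreeDist G j y ≤ mhMatrix G j x y := by
  have hd' : ∀ z : State G j, (1 : ℝ) ≤ (stateGraph G j).degree z := fun z => by
    exact_mod_cast hd z
  have hB0 : 0 < B := (zero_lt_one.trans_le (hd' x)).trans_le (hB x)
  have hN : (0 : ℝ) < Fintype.card (State G j) := by
    exact_mod_cast Fintype.card_pos_iff.2 ⟨x⟩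
  have hsum : (Fintype.card (State G j) : ℝ) ≤ ∑ w, ((stateGraph G j).degree w : ℝ) := by
    simpa using Finset.sum_le_sum fun (w : State G j) (_ : w ∈ Finset.univ) => hd' w
  have hlow : 1 / (2 * B) * degreeDist G j y ≤
      1 / (2 * Fintype.card (State G j)) * (((stateGraph G j).degree y : ℝ) / B) := by
    rw [degreeDist, div_mul_div_comm, div_mul_div_comm]
    refine div_le_div_of_nonneg_left (by positivity) (by positivity) ?_
    nlinarith
  have hacc : ∀ x : State G j, ((stateGraph G j).degree y : ℝ) / B ≤
      min 1 (((stateGraph G j).degree y : ℝ) / (stateGraph G j).degree x) := fun x => by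
    refine le_min ((div_le_one hB0).2 (hB y)) ?_
    exact div_le_div_of_nonneg_left (by positivity) (zero_lt_one.trans_le (hd' x)) (hB x)
  by_cases h : x = y
  · subst h
    refine hlow.trans ?_
    simp only [mhMatrix, if_true]
    have h1 : ∑ w ∈ Finset.univ.erase x, 1 / (2 * Fintype.card (State G j)) *
        min 1 (((stateGraph G j).degree w : ℝ) / (stateGraph G j).degree x) ≤
        ∑ w ∈ Finset.univ.erase x, (1 / (2 * Fintype.card (State G j)) : ℝ) := by
      refine Finset.sum_le_sum fun w _ => ?_
      exact mul_le_of_le_one_right (by positivity) (min_le_left _ _)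
    have h2 : ∑ w ∈ Finset.univ.erase x, (1 / (2 * Fintype.card (State G j)) : ℝ) +
        1 / (2 * Fintype.card (State G j)) = 1 / 2 := by
      rw [Finset.sum_erase_add _ _ (Finset.mem_univ x), Finset.sum_const, Finset.card_univ,
        nsmul_eq_mul]
      field_simp
    have h3 : 1 / (2 * (Fintype.card (State G j) : ℝ)) * (((stateGraph G j).degree x : ℝ) / B) ≤
        1 / (2 * Fintype.card (State G j)) :=
      mul_le_of_le_one_right (by positivity) ((div_le_one hB0).2 (hB x))
    linarith
  · refine hlow.trans ?_
    simp only [mhMatrix, if_neg h]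
    gcongr
    exact hacc x

theorem tvDist_le {j : ℕ} (hd : ∀ H : State G j, 0 < (stateGraph G j).degree H)
    {B : ℝ} (hB : ∀ H : State G j, ((stateGraph G j).degree H : ℝ) ≤ B) (x : State G j) (l : ℕ) :
    tvDist G j x l ≤ (1 - 1 / (2 * B)) ^ l := by
  have : Nonempty (State G j) := ⟨x⟩
  have hB1 : 1 ≤ B := le_trans (by exact_mod_cast hd x) (hB x)
  refine half_sum_abs_pow_sub_le (mhMatrix_sum j) (sum_degreeDist hd) (degreeDist_nonneg j) ?_
    (degreeDist_le_mhMatrix hd hB) ?_ x l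
  · intro y
    simp only [mhMatrix_reversible hd _ y, ← Finset.mul_sum, mhMatrix_sum, mul_one]
  · rw [div_le_one (by positivity)]
    linarith

/-- The distance after `l` steps is at most `(1 - 1 / (2 B)) ^ l ≤ exp (- l / (2 B))`. -/
theorem mixingTime_le {j : ℕ} (hd : ∀ H : State G j, 0 < (stateGraph G j).degree H)
    {B : ℝ} (hB : ∀ H : State G j, ((stateGraph G j).degree H : ℝ) ≤ B) {ε : ℝ} (hε : 0 < ε)
    {t : ℕ} (ht : 2 * B * Real.log ε⁻¹ ≤ t) : mixingTime G j ε ≤ t := by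
  refine iSup_le fun x => iInf₂_le t fun l hl => ?_
  have hB1 : 1 ≤ B := le_trans (by exact_mod_cast hd x) (hB x)
  have hB0 : 0 < 2 * B := by linarith
  refine (tvDist_le hd hB x l).trans ?_
  have h1 : 1 - 1 / (2 * B) ≤ Real.exp (-(1 / (2 * B))) := by
    have := Real.add_one_le_exp (-(1 / (2 * B)))
    linarith
  have h0 : 0 ≤ 1 - 1 / (2 * B) := by
    rw [sub_nonneg, div_le_one hB0]
    linarith
  calc (1 - 1 / (2 * B)) ^ l ≤ Real.exp (-(1 / (2 * B))) ^ l := by gcongr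
    _ = Real.exp (-(l / (2 * B))) := by rw [← Real.exp_nat_mul]; ring_nf
    _ ≤ Real.exp (Real.log ε) := by
      rw [Real.exp_le_exp, neg_le, ← Real.log_inv, le_div_iff₀ hB0, mul_comm]
      exact ht.trans (by exact_mod_cast hl)
    _ = ε := Real.exp_log hε

end

section

open Run

/-! ### The rejection loop -/

variable {V : Type*} [Fintype V] [DecidableEq V] {G : SimpleGraph V} [DecidableRel G.Adj]

theorem law_drawNeighbor {j : ℕ} (v : State G j) (u : {u // (stateGraph G j).Adj v u}) :
    (drawNeighbor G v).law u = ((stateGraph G j).degree v : ℝ≥0∞)⁻¹ := by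
  rw [drawNeighbor, law_draw, Finset.sum_const, Finset.card_univ,
    ← SimpleGraph.card_neighborSet_eq_degree]
  simp only [nsmul_eq_mul, Nat.cast_one, mul_one, one_div]
  rfl

theorem haltProb_drawNeighbor {j : ℕ} {v : State G j} (hv : 0 < (stateGraph G j).degree v) :
    (drawNeighbor G v).haltProb = 1 := by
  obtain ⟨u, hu⟩ := (SimpleGraph.degree_pos_iff_exists_adj _ _).1 hv
  exact haltProb_draw _ (a := ⟨u, hu⟩) one_ne_zero

theorem expectedTime_drawNeighbor {j : ℕ} {v : State G j} (hv : 0 < (stateGraph G j).degree v) :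
    (drawNeighbor G v).expectedTime = neighborPrice G j := by
  obtain ⟨u, hu⟩ := (SimpleGraph.degree_pos_iff_exists_adj _ _).1 hv
  exact expectedTime_draw _ (a := ⟨u, hu⟩) one_ne_zero

/-- The probability of accepting the connected subgraph `H`. -/
def acceptProb {j : ℕ} (H : State G (j + 1)) : ℝ≥0∞ :=
  min 1 ((((numSub G H).choose 2 : ℕ) : ℝ≥0∞)⁻¹)

/-- The acceptance test for a proposal `H` in the rejection loop. -/
def acceptTest {j : ℕ} (H : State G (j + 1)) : Run (Option (State G (j + 1))) :=
  (Run.tick (countPrice (j + 1))).bind fun _ =>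
    (Run.coin ((((numSub G H).choose 2 : ℕ) : ℝ≥0∞)⁻¹)).bind fun b =>
    Run.ret (if b then some H else none)

/-- One round of the rejection loop. -/
def rejectionRound (G : SimpleGraph V) [DecidableRel G.Adj] {j : ℕ} (hj : 2 ≤ j)
    (D : Run (State G j)) : Run (Option (State G (j + 1))) :=
  D.bind fun v => (drawNeighbor G v).bind fun u => acceptTest (union hj v u.1 u.2)

theorem rejectionLoop_eq {j : ℕ} (hj : 2 ≤ j) (D : Run (State G j)) :
    rejectionLoop G hj D = untilSome (rejectionRound G hj D) := rfl

omit [DecidableRel G.Adj] in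
theorem haltProb_acceptTest {j : ℕ} (H : State G (j + 1)) : (acceptTest H).haltProb = 1 :=
  haltProb_bind_eq_one (haltProb_tick _) fun _ =>
    haltProb_bind_eq_one (haltProb_coin _) fun _ => haltProb_ret _

omit [DecidableRel G.Adj] in
theorem expectedTime_acceptTest_le {j : ℕ} (H : State G (j + 1)) :
    (acceptTest H).expectedTime ≤ ((j + 1) ^ 3 + 1 : ℕ) := by
  refine (expectedTime_bind_le (t := 1) (haltProb_tick _) (fun _ => ?_) fun _ => ?_).trans ?_
  · exact haltProb_bind_eq_one (haltProb_coin _) fun _ => haltProb_ret _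
  · refine (expectedTime_bind_le (t := 0) (haltProb_coin _) (fun _ => haltProb_ret _)
      fun _ => by simp).trans ?_
    simp
  · simp [countPrice]

omit [DecidableRel G.Adj] in
theorem law_acceptTest {j : ℕ} (H : State G (j + 1)) (o : Option (State G (j + 1))) :
    (acceptTest H).law o =
      if o = some H then acceptProb H else if o = none then 1 - acceptProb H else 0 := by
  rw [acceptTest, law_bind, tsum_fintype]
  simp only [Finset.univ_unique, Finset.sum_singleton, law_tick, one_mul]
  rw [law_bind, tsum_fintype, Fintype.sum_bool]
  simp only [law_coin, law_ret, acceptProb]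
  rcases o with _ | F
  · simp
  · simp

omit [DecidableRel G.Adj] in
/-- A proposal is accepted with probability at least `1 / (j + 1 choose 2)`. -/
theorem le_acceptProb {j : ℕ} (hj : 1 ≤ j) (H : State G (j + 1)) :
    (((j + 1).choose 2 : ℕ) : ℝ≥0∞)⁻¹ ≤ acceptProb H := by
  refine le_min ?_ ?_
  · rw [ENNReal.inv_le_one]
    exact_mod_cast Nat.choose_pos (by omega)
  · gcongr
    exact numSub_le H

theorem haltProb_rejectionRound {j : ℕ} (hj : 2 ≤ j) {D : Run (State G j)}
    (hd : ∀ H : State G j, 0 < (stateGraph G j).degree H) (hD : D.haltProb = 1) :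
    (rejectionRound G hj D).haltProb = 1 :=
  haltProb_bind_eq_one hD fun v => haltProb_bind_eq_one (haltProb_drawNeighbor (hd v)) fun _ =>
    haltProb_acceptTest _

theorem expectedTime_rejectionRound_le {j : ℕ} (hj : 2 ≤ j) {D : Run (State G j)}
    (hd : ∀ H : State G j, 0 < (stateGraph G j).degree H) (hD : D.haltProb = 1) :
    (rejectionRound G hj D).expectedTime ≤
      D.expectedTime + (neighborPrice G j + ((j + 1) ^ 3 + 1 : ℕ)) := by
  refine expectedTime_bind_le hD (fun v => ?_) fun v => ?_
  · exact haltProb_bind_eq_one (haltProb_drawNeighbor (hd v)) fun _ => haltProb_acceptTest _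
  · refine (expectedTime_bind_le (haltProb_drawNeighbor (hd v)) (fun _ => haltProb_acceptTest _)
      fun _ => expectedTime_acceptTest_le _).trans ?_
    rw [expectedTime_drawNeighbor (hd v)]

/-- The rejection probability is bounded uniformly in the sampler `D`, so that no accuracy of `D` is
needed for the running time. -/
theorem law_none_rejectionRound_le {j : ℕ} (hj : 2 ≤ j) {D : Run (State G j)}
    (hd : ∀ H : State G j, 0 < (stateGraph G j).degree H) (hD : D.haltProb = 1) :
    (rejectionRound G hj D).law none ≤ 1 - (((j + 1).choose 2 : ℕ) : ℝ≥0∞)⁻¹ := by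
  have h0 : ∀ {α : Type _} (x : Run α) (f : α → Run (Option (State G (j + 1)))) (q : ℝ≥0∞),
      x.haltProb = 1 → (∀ a, (f a).law none ≤ q) → (x.bind f).law none ≤ q := by
    intro α x f q hx hf
    rw [law_bind]
    calc ∑' a, x.law a * (f a).law none ≤ ∑' a, x.law a * q := by gcongr; exact hf _
      _ = q := by rw [ENNReal.tsum_mul_right]; exact (congrArg (· * q) hx).trans (one_mul q)
  refine h0 _ _ _ hD fun v => h0 _ _ _ (haltProb_drawNeighbor (hd v)) fun u => ?_
  rw [law_acceptTest]
  simp only [reduceCtorEq, if_false, if_true]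
  gcongr
  exact le_acceptProb (by omega) _

theorem haltProb_rejectionLoop {j : ℕ} (hj : 2 ≤ j) {D : Run (State G j)}
    (hd : ∀ H : State G j, 0 < (stateGraph G j).degree H) (hD : D.haltProb = 1) :
    (rejectionLoop G hj D).haltProb = 1 := by
  refine haltProb_untilSome (haltProb_rejectionRound hj hd hD) ?_
  refine (law_none_rejectionRound_le hj hd hD).trans_lt ?_
  refine ENNReal.sub_lt_self ENNReal.one_ne_top one_ne_zero ?_
  simp

theorem expectedTime_rejectionLoop_le {j : ℕ} (hj : 2 ≤ j) {D : Run (State G j)}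
    (hd : ∀ H : State G j, 0 < (stateGraph G j).degree H) (hD : D.haltProb = 1) :
    (rejectionLoop G hj D).expectedTime ≤ ((j + 1).choose 2 : ℕ) *
      (D.expectedTime + (neighborPrice G j + ((j + 1) ^ 3 + 1 : ℕ))) := by
  have h := expectedTime_untilSome_le (haltProb_rejectionRound hj hd hD)
    (ENNReal.inv_ne_zero.2 (ENNReal.natCast_ne_top _)) ?_ (law_none_rejectionRound_le hj hd hD)
  · rw [inv_inv] at h
    refine h.trans ?_
    gcongr
    exact expectedTime_rejectionRound_le hj hd hD
  · rw [ENNReal.inv_le_one]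
    exact_mod_cast Nat.choose_pos (by omega)

/-- When `v` is drawn with probability proportional to its degree, every ordered pair of adjacent
states is proposed with the same probability `p`. Exactly `2 (m choose 2)` of these pairs have
union `H`, so the acceptance probability makes `H` appear with probability `2 p`. -/
theorem law_some_rejectionRound {j : ℕ} (hj : 2 ≤ j) {D : Run (State G j)} {p : ℝ≥0∞}
    (hd : ∀ H : State G j, 0 < (stateGraph G j).degree H)
    (hD : ∀ v, D.law v = (stateGraph G j).degree v * p) (H : State G (j + 1)) :
    (rejectionRound G hj D).law (some H) = 2 * p := by
  have hc : (numSub G H).choose 2 ≠ 0 :=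
    (Nat.choose_pos (two_le_numSub (by omega) H)).ne'
  have hround : ∀ v : State G j,
      D.law v * ((drawNeighbor G v).bind fun u => acceptTest (union hj v u.1 u.2)).law (some H) =
        p * acceptProb H * ∑ u : State G j,
          ((if (v.1 ⊆ H.1 ∧ u.1 ⊆ H.1) ∧ v ≠ u then 1 else 0 : ℕ) : ℝ≥0∞) := by
    intro v
    have hdv : ((stateGraph G j).degree v : ℝ≥0∞) ≠ 0 := by exact_mod_cast (hd v).ne'
    have hsum : ∑ u : {u // (stateGraph G j).Adj v u},
        (acceptTest (union hj v u.1 u.2)).law (some H) = acceptProb H * ∑ u : State G j,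
          ((if (v.1 ⊆ H.1 ∧ u.1 ⊆ H.1) ∧ v ≠ u then 1 else 0 : ℕ) : ℝ≥0∞) := by
      rw [Finset.mul_sum, ← Finset.sum_filter_of_ne (p := fun u => (stateGraph G j).Adj v u),
        Finset.sum_subtype (p := fun u => (stateGraph G j).Adj v u) _ (by simp)]
      · refine Finset.sum_congr rfl fun u _ => ?_
        rw [law_acceptTest]
        simp only [reduceCtorEq, if_false, Option.some_inj, ← adj_and_union_eq_iff hj H v u]
        by_cases h : union hj v u.1 u.2 = H
        · simp [h, u.2]
        · simp [h, Ne.symm h]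
      · intro u _ hu
        by_contra hadj
        refine hu ?_
        simp only [← adj_and_union_eq_iff hj H v u]
        simp [hadj]
    rw [law_bind, hD v, tsum_fintype]
    simp only [law_drawNeighbor, ← Finset.mul_sum]
    rw [hsum, mul_comm _ p, mul_assoc p, ← mul_assoc ((stateGraph G j).degree v : ℝ≥0∞),
      ENNReal.mul_inv_cancel hdv (ENNReal.natCast_ne_top _), one_mul, mul_assoc]
  rw [rejectionRound, law_bind, tsum_fintype]
  simp only [hround]
  rw [← Finset.mul_sum]
  have h2 := card_pairs H
  have h3 : ∑ v : State G j, ∑ u : State G j,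
      ((if (v.1 ⊆ H.1 ∧ u.1 ⊆ H.1) ∧ v ≠ u then 1 else 0 : ℕ) : ℝ≥0∞) =
      2 * (((numSub G H).choose 2 : ℕ) : ℝ≥0∞) := by
    exact_mod_cast congrArg (Nat.cast (R := ℝ≥0∞)) h2
  have h4 : acceptProb H = (((numSub G H).choose 2 : ℕ) : ℝ≥0∞)⁻¹ := by
    refine min_eq_right ?_
    rw [ENNReal.inv_le_one]
    exact_mod_cast Nat.pos_of_ne_zero hc
  rw [h3, h4, mul_assoc, mul_left_comm _ 2, ENNReal.inv_mul_cancel (by exact_mod_cast hc)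
    (ENNReal.natCast_ne_top _), mul_one, mul_comm]

/-- Every `H` is equally likely to be returned by a round, hence also by the loop, which halts with
probability one. -/
theorem law_rejectionLoop {j : ℕ} (hj : 2 ≤ j) {D : Run (State G j)}
    (hd : ∀ H : State G j, 0 < (stateGraph G j).degree H) [Nonempty (State G j)]
    (hD : ∀ v, D.law v = ENNReal.ofReal (degreeDist G j v)) (H : State G (j + 1)) :
    (rejectionLoop G hj D).law H = (Fintype.card (State G (j + 1)) : ℝ≥0∞)⁻¹ := by
  set p : ℝ≥0∞ := (∑ w : State G j, ((stateGraph G j).degree w : ℝ≥0∞))⁻¹ with hp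
  have hD1 : D.haltProb = 1 := by
    simp only [haltProb, hD, tsum_fintype]
    rw [← ENNReal.ofReal_sum_of_nonneg fun v _ => degreeDist_nonneg j v, sum_degreeDist hd,
      ENNReal.ofReal_one]
  have hDp : ∀ v, D.law v = (stateGraph G j).degree v * p := fun v => by
    rw [hD, degreeDist, ENNReal.ofReal_div_of_pos, hp, ← div_eq_mul_inv]
    · congr 1
      · exact ENNReal.ofReal_natCast _
      · rw [ENNReal.ofReal_sum_of_nonneg fun _ _ => by positivity]
        simp only [ENNReal.ofReal_natCast]
    · refine Finset.sum_pos (fun w _ => ?_) Finset.univ_nonempty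
      exact_mod_cast hd w
  have hs := law_some_rejectionRound hj hd hDp
  have hb := haltProb_rejectionRound hj hd hD1
  have hlt : (rejectionRound G hj D).law none < 1 := by
    refine (law_none_rejectionRound_le hj hd hD1).trans_lt ?_
    refine ENNReal.sub_lt_self ENNReal.one_ne_top one_ne_zero ?_
    simp
  have h1 := haltProb_untilSome hb hlt
  have h2 : ∀ F, (rejectionLoop G hj D).law F =
      (1 - (rejectionRound G hj D).law none)⁻¹ * (2 * p) := fun F => by
    rw [rejectionLoop_eq, law_untilSome, hs]
  rw [← rejectionLoop_eq, haltProb, tsum_fintype] at h1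
  simp only [h2, Finset.sum_const, Finset.card_univ, nsmul_eq_mul] at h1
  rw [h2]
  exact ENNReal.eq_inv_of_mul_eq_one_left (by rw [mul_comm]; exact h1)

/-! ### The Metropolis–Hastings loop -/

theorem haltProb_mhStep {j : ℕ} {U : Run (State G j)} (hU : U.haltProb = 1) (v : State G j) :
    (mhStep G U v).haltProb = 1 := by
  refine haltProb_bind_eq_one (haltProb_coin _) fun b => ?_
  cases b
  · simp
  · exact haltProb_bind_eq_one hU fun _ => haltProb_bind_eq_one (haltProb_tick _) fun _ =>
      haltProb_bind_eq_one (haltProb_coin _) fun _ => haltProb_ret _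

theorem expectedTime_mhStep_le {j : ℕ} {U : Run (State G j)} (hU : U.haltProb = 1)
    (v : State G j) :
    (mhStep G U v).expectedTime ≤ 1 + (U.expectedTime + (degreePrice G j + 1)) := by
  refine (expectedTime_bind_le (t := U.expectedTime + (degreePrice G j + 1)) (haltProb_coin _)
    (fun b => ?_) fun b => ?_).trans_eq (by rw [expectedTime_coin])
  · cases b
    · simp
    · exact haltProb_bind_eq_one hU fun _ => haltProb_bind_eq_one (haltProb_tick _) fun _ =>
        haltProb_bind_eq_one (haltProb_coin _) fun _ => haltProb_ret _
  · cases b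
    · simp
    · refine expectedTime_bind_le hU (fun _ => ?_) fun w => ?_
      · exact haltProb_bind_eq_one (haltProb_tick _) fun _ =>
          haltProb_bind_eq_one (haltProb_coin _) fun _ => haltProb_ret _
      refine (expectedTime_bind_le (t := 1) (haltProb_tick _) (fun _ => ?_) fun _ => ?_).trans_eq
        (by rw [expectedTime_tick])
      · exact haltProb_bind_eq_one (haltProb_coin _) fun _ => haltProb_ret _
      · refine (expectedTime_bind_le (t := 0) (haltProb_coin _) (fun _ => haltProb_ret _)
          fun _ => by simp).trans_eq (by simp)

theorem haltProb_mhLoop {j : ℕ} {U : Run (State G j)} (hU : U.haltProb = 1) (t : ℕ)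
    (v : State G j) : (mhLoop G U t v).haltProb = 1 := by
  induction t generalizing v with
  | zero => exact haltProb_ret v
  | succ t ih => exact haltProb_bind_eq_one (haltProb_mhStep hU v) ih

theorem expectedTime_mhLoop_le {j : ℕ} {U : Run (State G j)} (hU : U.haltProb = 1) (t : ℕ)
    (v : State G j) :
    (mhLoop G U t v).expectedTime ≤ t * (1 + (U.expectedTime + (degreePrice G j + 1))) := by
  induction t generalizing v with
  | zero => simp [mhLoop]
  | succ t ih =>
    refine (expectedTime_bind_le (haltProb_mhStep hU v) (haltProb_mhLoop hU t) ih).trans ?_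
    rw [Nat.cast_succ, add_mul, one_mul, add_comm]
    gcongr
    exact expectedTime_mhStep_le hU v

/-! ### The recursive samplers -/

theorem haltProb_degreePropSampling_succ {T : ℕ → ℕ} {j : ℕ}
    (hU : (uniformSampling G T (j + 3)).haltProb = 1) :
    (degreePropSampling G T (j + 3)).haltProb = 1 := by
  rw [degreePropSampling]
  exact haltProb_bind_eq_one hU fun v => haltProb_bind_eq_one (haltProb_tick _) fun _ =>
    haltProb_mhLoop hU _ v

theorem expectedTime_degreePropSampling_le {T : ℕ → ℕ} {j : ℕ}
    (hU : (uniformSampling G T (j + 3)).haltProb = 1) :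
    (degreePropSampling G T (j + 3)).expectedTime ≤
      (uniformSampling G T (j + 3)).expectedTime + (degreePrice G (j + 3) + T (j + 3) *
        (1 + ((uniformSampling G T (j + 3)).expectedTime + (degreePrice G (j + 3) + 1)))) := by
  rw [degreePropSampling]
  refine expectedTime_bind_le hU (fun v => ?_) fun v => ?_
  · exact haltProb_bind_eq_one (haltProb_tick _) fun _ => haltProb_mhLoop hU _ v
  · exact (expectedTime_bind_le (haltProb_tick _) (fun _ => haltProb_mhLoop hU _ v)
      fun _ => expectedTime_mhLoop_le hU _ v).trans_eq (by rw [expectedTime_tick])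

/-- An edge that has a neighbour outside has positive weight. -/
theorem degreeWeight_ne_zero {k : ℕ} (hk : 3 ≤ k)
    (hK : ∀ K : G.ConnectedComponent, k ≤ K.supp.ncard) (e : State G 2) :
    (∑ v ∈ e.1, G.degree v) - 2 ≠ 0 := by
  obtain ⟨a, ha, c, hc, hac⟩ := exists_adj_not_mem hK (by omega) (by omega : 2 < k) e
  have : Nontrivial (e.1 : Set V) := by
    rw [Set.nontrivial_coe_sort]
    refine Finset.one_lt_card_iff_nontrivial.1 ?_
    rw [e.2.1]; omega
  obtain ⟨b, hb⟩ := e.2.2.preconnected.exists_adj_of_nontrivial ⟨a, ha⟩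
  have hab : G.Adj a b := hb
  have h1 : 2 ≤ G.degree a := by
    rw [← SimpleGraph.card_neighborFinset_eq_degree]
    refine Finset.one_lt_card.2 ⟨b, by simpa using hab, c, by simpa using hac, ?_⟩
    rintro h
    exact hc (h ▸ b.2)
  have h2 : 1 ≤ G.degree b := (G.degree_pos_iff_exists_adj _).2 ⟨a, hab.symm⟩
  have h3 : ∑ v ∈ ({a, b.1} : Finset V), G.degree v ≤ ∑ v ∈ e.1, G.degree v := by
    refine Finset.sum_le_sum_of_subset ?_
    intro x hx
    rw [Finset.mem_insert, Finset.mem_singleton] at hx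
    rcases hx with rfl | rfl
    · exact ha
    · exact b.2
  rw [Finset.sum_pair hab.ne] at h3
  omega

theorem haltProb_degreePropSampling_two {k : ℕ} (hk : 3 ≤ k) [Nonempty V]
    (hK : ∀ K : G.ConnectedComponent, k ≤ K.supp.ncard) (T : ℕ → ℕ) :
    (degreePropSampling G T 2).haltProb = 1 := by
  obtain ⟨e⟩ := nonempty_state hK (j := 2) (by omega) (by omega)
  rw [degreePropSampling]
  exact haltProb_draw 1 (a := e) (degreeWeight_ne_zero hk hK e)

theorem expectedTime_degreePropSampling_two {k : ℕ} (hk : 3 ≤ k) [Nonempty V]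
    (hK : ∀ K : G.ConnectedComponent, k ≤ K.supp.ncard) (T : ℕ → ℕ) :
    (degreePropSampling G T 2).expectedTime = 1 := by
  obtain ⟨e⟩ := nonempty_state hK (j := 2) (by omega) (by omega)
  rw [degreePropSampling]
  rw [expectedTime_draw 1 (a := e) (degreeWeight_ne_zero hk hK e), Nat.cast_one]

theorem haltProb_uniformSampling {k : ℕ} (hk : 3 ≤ k) [Nonempty V]
    (hK : ∀ K : G.ConnectedComponent, k ≤ K.supp.ncard) (T : ℕ → ℕ) {j : ℕ} (hj : j + 3 ≤ k) :
    (uniformSampling G T (j + 3)).haltProb = 1 := by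
  rw [uniformSampling]
  refine haltProb_rejectionLoop _ (degree_stateGraph_pos hK (by omega) (by omega)) ?_
  induction j with
  | zero => exact haltProb_degreePropSampling_two hk hK T
  | succ j ih =>
    refine haltProb_degreePropSampling_succ ?_
    rw [uniformSampling]
    exact haltProb_rejectionLoop _ (degree_stateGraph_pos hK (by omega) (by omega)) (ih (by omega))

end

section

open Run

/-! ### Bounds on the loop lengths -/

variable {V : Type*} [Fintype V] [DecidableEq V] {G : SimpleGraph V}

omit [DecidableEq V] in
theorem le_card_vertices [Nonempty V] {k : ℕ}
    (hK : ∀ K : G.ConnectedComponent, k ≤ K.supp.ncard) : k ≤ Fintype.card V := by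
  obtain ⟨v⟩ := ‹Nonempty V›
  refine (hK (G.connectedComponentMk v)).trans ?_
  rw [← Nat.card_eq_fintype_card]
  exact Set.ncard_le_card _

theorem maxDegree_pos [DecidableRel G.Adj] [Nonempty V] {k : ℕ} (hk : 2 ≤ k)
    (hK : ∀ K : G.ConnectedComponent, k ≤ K.supp.ncard) : 0 < G.maxDegree := by
  obtain ⟨H⟩ := nonempty_state hK le_rfl (by omega : 1 ≤ k)
  obtain ⟨a, -, b, -, hab⟩ := exists_adj_not_mem hK le_rfl (by omega : 1 < k) H
  exact ((G.degree_pos_iff_exists_adj a).2 ⟨b, hab⟩).trans_le (G.degree_le_maxDegree a)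

theorem one_le_log_of_three_le {x : ℝ} (hx : 3 ≤ x) : 1 ≤ Real.log x := by
  rw [Real.le_log_iff_exp_le (by linarith)]
  linarith [Real.exp_one_lt_d9]

/-- The factor by which the loop at level `j` may exceed a bound with a constant that does not
depend on `ε`. It differs from `1` only for the finitely many `j < exp |ln ε|`, so that the product
of all these factors is bounded in terms of `ε`. -/
def levelFactor (ε : ℝ) (j : ℕ) : ℝ :=
  if (j : ℝ) < Real.exp |Real.log ε| then 1 + |Real.log ε| else 1

theorem one_le_levelFactor (ε : ℝ) (j : ℕ) : 1 ≤ levelFactor ε j := by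
  unfold levelFactor
  split_ifs
  · linarith [abs_nonneg (Real.log ε)]
  · exact le_rfl

theorem prod_levelFactor_le (ε : ℝ) (i : ℕ) :
    ∏ m ∈ Finset.range i, levelFactor ε (m + 3) ≤
      (1 + |Real.log ε|) ^ ⌈Real.exp |Real.log ε|⌉₊ := by
  have h1 : 1 ≤ 1 + |Real.log ε| := by linarith [abs_nonneg (Real.log ε)]
  simp only [levelFactor]
  rw [Finset.prod_ite, Finset.prod_const, Finset.prod_const_one, mul_one]
  refine pow_le_pow_right₀ h1 ?_
  calc _ ≤ (Finset.range ⌈Real.exp |Real.log ε|⌉₊).card := Finset.card_le_card ?_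
    _ = _ := Finset.card_range _
  intro m hm
  rw [Finset.mem_filter] at hm
  rw [Finset.mem_range, Nat.lt_ceil]
  have := hm.2
  push_cast at this
  linarith

/-- For `j` beyond `exp |ln ε|` the assumption `ln j ≤ L` alone bounds `|ln ε|` by `L`. -/
theorem abs_log_le_levelFactor_mul {ε L : ℝ} {j : ℕ} (hj : 0 < j) (hL : 1 ≤ L)
    (hjL : Real.log j ≤ L) : |Real.log ε| ≤ levelFactor ε j * L := by
  have h0 := abs_nonneg (Real.log ε)
  unfold levelFactor
  split_ifs with h
  · nlinarith
  · rw [one_mul]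
    refine le_trans ?_ hjL
    rw [Real.le_log_iff_exp_le (by exact_mod_cast hj)]
    exact not_lt.1 h

theorem log_inv_le_abs (ε : ℝ) : Real.log ε⁻¹ ≤ |Real.log ε| := by
  rw [Real.log_inv]
  exact neg_le_abs _

theorem mixingTime_le_of_maxDegree [DecidableRel G.Adj] {k : ℕ}
    (hK : ∀ K : G.ConnectedComponent, k ≤ K.supp.ncard) {j : ℕ} (hj : 2 ≤ j) (hjk : j < k)
    {ε : ℝ} (hε : 0 < ε) {t : ℕ} (ht : 2 * ((j : ℝ) ^ 2 * G.maxDegree) * |Real.log ε| ≤ t) :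
    mixingTime G j ε ≤ t := by
  refine mixingTime_le (B := (j : ℝ) ^ 2 * G.maxDegree)
    (degree_stateGraph_pos hK (by omega) hjk) (fun H => ?_) hε (le_trans ?_ ht)
  · exact_mod_cast degree_stateGraph_le hj H
  · gcongr
    exact log_inv_le_abs ε

/-- Since `j < k ≤ |V|`, the term `ln ε⁻¹` is absorbed by `ln |V|` up to the level factor, both in
the bound on the mixing time and in the explicit number of steps. -/
theorem loopLength_le [DecidableRel G.Adj] [Nonempty V] {k : ℕ}
    (hK : ∀ K : G.ConnectedComponent, k ≤ K.supp.ncard) {j : ℕ} (hj : 3 ≤ j) (hjk : j < k)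
    {ε : ℝ} (hε : 0 < ε) {t : ℕ}
    (ht : (t : ℕ∞) ≤ max (mixingTime G j ε) (⌈explicitSteps G j ε⌉₊ : ℕ∞)) :
    (t : ℝ) ≤ 7 * ((j : ℝ) ^ 2 * G.maxDegree * Real.log (Fintype.card V) * levelFactor ε j) := by
  have hjn : j ≤ Fintype.card V := hjk.le.trans (le_card_vertices hK)
  have hΔ : (1 : ℝ) ≤ G.maxDegree := by exact_mod_cast maxDegree_pos (by omega) hK
  have hj3 : (3 : ℝ) ≤ j := by exact_mod_cast hj
  set L := Real.log (Fintype.card V) with hLdef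
  have hL : 1 ≤ L := one_le_log_of_three_le (by exact_mod_cast hj.trans hjn)
  have hjL : Real.log j ≤ L := Real.log_le_log (by linarith) (by exact_mod_cast hjn)
  have hΔL : Real.log G.maxDegree ≤ L :=
    Real.log_le_log (by linarith) (by exact_mod_cast G.maxDegree_lt_card_verts.le)
  have hg := one_le_levelFactor ε j
  have hM := abs_log_le_levelFactor_mul (ε := ε) (by omega : 0 < j) hL hjL
  set g := levelFactor ε j
  set X := (j : ℝ) ^ 2 * G.maxDegree * L * g with hX
  have hjΔ : 1 ≤ (j : ℝ) ^ 2 * G.maxDegree := by nlinarith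
  have hX1 : 1 ≤ X := by
    have : 1 ≤ (j : ℝ) ^ 2 * G.maxDegree * L := by nlinarith
    nlinarith
  have hmix : 2 * ((j : ℝ) ^ 2 * G.maxDegree) * |Real.log ε| ≤ 6 * X := by
    have := mul_le_mul_of_nonneg_left hM (zero_le_one.trans hjΔ)
    nlinarith
  have hexp : explicitSteps G j ε ≤ 6 * X := by
    have hgL : L ≤ g * L := by nlinarith
    have h1 : Real.log j + Real.log G.maxDegree + j * L + Real.log ε⁻¹ ≤ 3 * (j * (g * L)) := by
      have := log_inv_le_abs ε
      nlinarith
    calc explicitSteps G j ε ≤ 2 * j * G.maxDegree * (3 * (j * (g * L))) := by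
          unfold explicitSteps
          gcongr
      _ = 6 * X := by rw [hX]; ring
  have h1 : mixingTime G j ε ≤ (⌈6 * X⌉₊ : ℕ∞) :=
    mixingTime_le_of_maxDegree hK (by omega) hjk hε (hmix.trans (Nat.le_ceil _))
  -- Both the mixing time and the explicit number of steps are at most `⌈6 X⌉`.
  have h2 : t ≤ ⌈6 * X⌉₊ := by
    have := ht.trans (max_le h1 (Nat.cast_le.2 (Nat.ceil_mono hexp)))
    exact_mod_cast this
  have h3 := Nat.ceil_lt_add_one (a := 6 * X) (by linarith)
  have h4 : (t : ℝ) ≤ ⌈6 * X⌉₊ := by exact_mod_cast h2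
  linarith

/-! ### The recursion for the running time -/

/-- The bound on the running time of `UniformSampling` for subgraphs with `i + 3` vertices, where
`g m` is the factor lost at level `m + 3`. -/
def costBound (g : ℕ → ℝ) (Δ L : ℝ) (i : ℕ) : ℝ :=
  (∏ m ∈ Finset.range i, g m) * 33 ^ i * ((i + 3)! : ℝ) ^ 2 * ((i + 2)! : ℝ) ^ 2 * Δ ^ i * L ^ i

theorem costBound_succ (g : ℕ → ℝ) (Δ L : ℝ) (i : ℕ) :
    costBound g Δ L (i + 1) =
      33 * (i + 4) ^ 2 * ((i + 3) ^ 2 * Δ * L * g i) * costBound g Δ L i := by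
  simp only [costBound, Finset.prod_range_succ, Nat.factorial_succ (i + 3),
    Nat.factorial_succ (i + 2), show i + 1 + 3 = i + 3 + 1 by ring,
    show i + 1 + 2 = i + 2 + 1 by ring]
  push_cast
  ring

theorem one_le_mul_levels {g : ℕ → ℝ} {Δ L : ℝ} (hg : ∀ m, 1 ≤ g m) (hΔ : 1 ≤ Δ) (hL : 1 ≤ L)
    (i : ℕ) : (i + 3 : ℝ) ^ 2 * Δ ≤ (i + 3) ^ 2 * Δ * L * g i := by
  have h0 : 0 ≤ (i + 3 : ℝ) ^ 2 * Δ := by positivity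
  rw [mul_assoc _ L]
  exact le_mul_of_one_le_right h0 (one_le_mul_of_one_le_of_one_le hL (hg i))

theorem sq_le_costBound {g : ℕ → ℝ} {Δ L : ℝ} (hg : ∀ m, 1 ≤ g m) (hΔ : 1 ≤ Δ) (hL : 1 ≤ L)
    (i : ℕ) : (i + 3 : ℝ) ^ 2 ≤ costBound g Δ L i := by
  induction i with
  | zero => norm_num [costBound, Nat.factorial]
  | succ i ih =>
    rw [costBound_succ]
    have h1 := one_le_mul_levels hg hΔ hL i
    have hi : (0 : ℝ) ≤ i := i.cast_nonneg
    have h2 : 1 ≤ (i + 3 : ℝ) ^ 2 * Δ * L * g i := by nlinarith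
    have h3 : 1 ≤ costBound g Δ L i := by nlinarith
    push_cast
    calc (i + 1 + 3 : ℝ) ^ 2 ≤ 33 * (i + 4) ^ 2 := by nlinarith
      _ ≤ 33 * (i + 4) ^ 2 * ((i + 3) ^ 2 * Δ * L * g i) * costBound g Δ L i := by
        rw [mul_assoc (33 * _)]
        exact le_mul_of_one_le_right (by positivity) (one_le_mul_of_one_le_of_one_le h2 h3)

omit [DecidableEq V] in
/-- For `j ≥ 4` the factor `Δ` in the price of a degree is covered by a factor `Δ` of the bound; for
`j = 3`, where the bound has none, a degree is looked up in one step. -/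
theorem degreePrice_le_costBound [DecidableRel G.Adj] {g : ℕ → ℝ} {L : ℝ} (hg : ∀ m, 1 ≤ g m)
    (hΔ : (1 : ℝ) ≤ G.maxDegree) (hL : 1 ≤ L) (i : ℕ) :
    (degreePrice G (i + 3) : ℝ) ≤ costBound g G.maxDegree L i := by
  cases i with
  | zero => norm_num [degreePrice, costBound, Nat.factorial]
  | succ i =>
    rw [costBound_succ, degreePrice, if_neg (by omega)]
    have h1 := one_le_mul_levels hg hΔ hL i
    have hi : (0 : ℝ) ≤ i := i.cast_nonneg
    have h3 : 1 ≤ costBound g G.maxDegree L i := by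
      have := sq_le_costBound hg hΔ hL i
      nlinarith
    push_cast
    calc (i + 1 + 3 : ℝ) ^ 4 * G.maxDegree
        = (i + 4 : ℝ) ^ 2 * ((i + 4) ^ 2 * G.maxDegree) := by ring
      _ ≤ (i + 4 : ℝ) ^ 2 * (33 * (i + 3) ^ 2 * G.maxDegree) := by
        gcongr
        nlinarith
      _ = 33 * (i + 4 : ℝ) ^ 2 * ((i + 3) ^ 2 * G.maxDegree) := by ring
      _ ≤ 33 * (i + 4 : ℝ) ^ 2 * ((i + 3) ^ 2 * G.maxDegree * L * g i) := by gcongr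
      _ ≤ _ := le_mul_of_one_le_right
        (mul_nonneg (by positivity) (le_trans (by positivity) h1)) h3

/-- The arithmetic of one level of the recursion: `X` is the order of the loop length `t`, and `u`
bounds the running time one level below and the prices `p`, `q` of the operations on states. -/
theorem level_cost_le {j u X t p q : ℝ} (hj : 3 ≤ j) (hu : j ^ 2 ≤ u) (hX : j ^ 2 ≤ X)
    (ht : t ≤ 7 * X) (hp0 : 0 ≤ p) (hp : p ≤ u) (hq : q ≤ u * X) :
    (j + 1) * j / 2 * ((u + (p + t * (1 + (u + (p + 1))))) + (q + ((j + 1) ^ 3 + 1))) ≤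
      33 * (j + 1) ^ 2 * X * u := by
  have hu1 : 1 ≤ u := by nlinarith
  have hX1 : 1 ≤ X := by nlinarith
  have huX : u ≤ u * X := le_mul_of_one_le_right (by linarith) hX1
  have h1 : t * (1 + (u + (p + 1))) ≤ 28 * (u * X) := by
    calc t * (1 + (u + (p + 1))) ≤ 7 * X * (4 * u) := by
          apply mul_le_mul ht (by linarith) (by linarith) (by linarith)
      _ = _ := by ring
  have h2 : (j + 1) ^ 3 + 1 ≤ 3 * (u * X) := by
    have h3 : j ^ 2 * j ^ 2 ≤ u * X := mul_le_mul hu hX (by positivity) (by linarith)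
    have h4 : (j + 1) ^ 3 ≤ (2 * j) ^ 3 * (8 / 27) := by
      have : j + 1 ≤ 4 / 3 * j := by linarith
      calc (j + 1) ^ 3 ≤ (4 / 3 * j) ^ 3 := by gcongr
        _ = _ := by ring
    have h5 : 3 * j ^ 3 ≤ j ^ 2 * j ^ 2 := by
      have : 0 ≤ j ^ 3 * (j - 3) := mul_nonneg (by positivity) (by linarith)
      nlinarith
    nlinarith
  calc _ ≤ (j + 1) * j / 2 * (34 * (u * X)) := by
        gcongr
        linarith
    _ ≤ (j + 1) * (j + 1) / 2 * (34 * (u * X)) := by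
        gcongr
        linarith
    _ = 17 * ((j + 1) ^ 2 * (u * X)) := by ring
    _ ≤ 33 * ((j + 1) ^ 2 * (u * X)) := by gcongr; norm_num
    _ = _ := by ring

theorem expectedTime_uniformSampling_succ_le [DecidableRel G.Adj] [Nonempty V] {k : ℕ}
    (hk : 3 ≤ k) (hK : ∀ K : G.ConnectedComponent, k ≤ K.supp.ncard) (T : ℕ → ℕ) {i : ℕ}
    (hi : i + 4 ≤ k) {u : ℝ} (hu0 : 0 ≤ u)
    (hu : (uniformSampling G T (i + 3)).expectedTime ≤ ENNReal.ofReal u) :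
    (uniformSampling G T (i + 4)).expectedTime ≤
      ENNReal.ofReal ((((i + 4).choose 2 : ℕ) : ℝ) *
        ((u + (degreePrice G (i + 3) + T (i + 3) * (1 + (u + (degreePrice G (i + 3) + 1))))) +
          (neighborPrice G (i + 3) + ((i + 4 : ℝ) ^ 3 + 1)))) := by
  have hU := haltProb_uniformSampling hk hK T (by omega : i + 3 ≤ k)
  lift u to NNReal using hu0
  rw [ENNReal.ofReal_coe_nnreal] at hu
  rw [uniformSampling]
  refine (expectedTime_rejectionLoop_le _ (degree_stateGraph_pos hK (by omega) (by omega))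
    (haltProb_degreePropSampling_succ hU)).trans ?_
  calc _ ≤ (((i + 4).choose 2 : ℕ) : ℝ≥0∞) *
        ((u + (degreePrice G (i + 3) + T (i + 3) * (1 + (u + (degreePrice G (i + 3) + 1))))) +
          (neighborPrice G (i + 3) + ((i + 4) ^ 3 + 1 : ℕ))) := by
        gcongr
        refine (expectedTime_degreePropSampling_le hU).trans ?_
        gcongr
    _ = (((((i + 4).choose 2 : ℕ) : NNReal) *
        ((u + (degreePrice G (i + 3) + T (i + 3) * (1 + (u + (degreePrice G (i + 3) + 1))))) +
          (neighborPrice G (i + 3) + ((i + 4) ^ 3 + 1 : ℕ))) : NNReal) : ℝ≥0∞) := by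
        push_cast
        rfl
    _ ≤ _ := by
        rw [← ENNReal.ofReal_coe_nnreal]
        refine ENNReal.ofReal_le_ofReal (le_of_eq ?_)
        push_cast
        rfl

/-- At most `3 = (3 choose 2)` rounds are expected, each of `1 + 1 + 3 ^ 3 + 1 = 30` steps. -/
theorem expectedTime_uniformSampling_three_le [DecidableRel G.Adj] [Nonempty V] {k : ℕ}
    (hk : 3 ≤ k) (hK : ∀ K : G.ConnectedComponent, k ≤ K.supp.ncard) (T : ℕ → ℕ) :
    (uniformSampling G T 3).expectedTime ≤ 90 := by
  rw [uniformSampling]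
  refine (expectedTime_rejectionLoop_le _ (degree_stateGraph_pos hK (by omega) (by omega))
    (haltProb_degreePropSampling_two hk hK T)).trans ?_
  rw [expectedTime_degreePropSampling_two hk hK, neighborPrice, if_pos le_rfl]
  norm_num [Nat.choose]

theorem expectedTime_uniformSampling_le [DecidableRel G.Adj] [Nonempty V] {k : ℕ}
    (hk : 3 ≤ k) (hK : ∀ K : G.ConnectedComponent, k ≤ K.supp.ncard) {ε : ℝ} (hε : 0 < ε)
    {T : ℕ → ℕ} (hT : ∀ j : ℕ, 3 ≤ j → j < k →
      (T j : ℕ∞) ≤ max (mixingTime G j ε) (⌈explicitSteps G j ε⌉₊ : ℕ∞)) {i : ℕ}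
    (hi : i + 3 ≤ k) :
    (uniformSampling G T (i + 3)).expectedTime ≤
      ENNReal.ofReal (costBound (fun m => levelFactor ε (m + 3)) G.maxDegree
        (Real.log (Fintype.card V)) i) := by
  have hΔ : (1 : ℝ) ≤ G.maxDegree := by exact_mod_cast maxDegree_pos (by omega) hK
  have hL : 1 ≤ Real.log (Fintype.card V) :=
    one_le_log_of_three_le (by exact_mod_cast hk.trans (le_card_vertices hK))
  have hg : ∀ m, 1 ≤ (fun m => levelFactor ε (m + 3)) m := fun m => one_le_levelFactor ε (m + 3)
  induction i with
  | zero =>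
    refine (expectedTime_uniformSampling_three_le hk hK T).trans ?_
    rw [← ENNReal.ofReal_ofNat]
    refine ENNReal.ofReal_le_ofReal ?_
    norm_num [costBound, Nat.factorial]
  | succ i ih =>
    have hu := sq_le_costBound hg hΔ hL i
    have hp := degreePrice_le_costBound hg hΔ hL i
    have hX := one_le_mul_levels hg hΔ hL i
    have ht := loopLength_le hK (by omega : 3 ≤ i + 3) (by omega) hε
      (hT (i + 3) (by omega) (by omega))
    have hs := costBound_succ (fun m => levelFactor ε (m + 3)) G.maxDegree
      (Real.log (Fintype.card V)) i
    set u := costBound (fun m => levelFactor ε (m + 3)) G.maxDegree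
      (Real.log (Fintype.card V)) i
    have hi0 : (0 : ℝ) ≤ i := i.cast_nonneg
    refine (expectedTime_uniformSampling_succ_le hk hK T (by omega) (by nlinarith)
      (ih (by omega))).trans (ENNReal.ofReal_le_ofReal ?_)
    rw [hs]
    push_cast at ht
    set X := (i + 3 : ℝ) ^ 2 * G.maxDegree * Real.log (Fintype.card V) * levelFactor ε (i + 3)
    have hX2 : (i + 3 : ℝ) ^ 2 ≤ X := by
      refine le_trans ?_ hX
      exact le_mul_of_one_le_right (by positivity) hΔ
    have hq : (neighborPrice G (i + 3) : ℝ) ≤ u * X := by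
      rw [neighborPrice, if_neg (by omega)]
      push_cast
      calc (i + 3 : ℝ) ^ 4 * G.maxDegree = (i + 3) ^ 2 * ((i + 3) ^ 2 * G.maxDegree) := by ring
        _ ≤ u * X := mul_le_mul hu hX (by positivity) (by nlinarith)
    have hlev := level_cost_le (j := (i + 3 : ℝ)) (by linarith) hu hX2 ht
      (Nat.cast_nonneg (degreePrice G (i + 3))) hp hq
    rw [Nat.cast_choose_two]
    push_cast
    rw [show (i + 3 + 1 : ℝ) = i + 4 by ring] at hlev
    rw [show (i + 4 - 1 : ℝ) = i + 3 by ring]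
    exact hlev

end

end RSS

end

theorem mainTheorem1 :
    ∃ c : ℝ, 0 < c ∧ ∀ ε : ℝ, 0 < ε → ∃ C : ℝ, 0 < C ∧
      ∀ (V : Type*) [Fintype V] [DecidableEq V] [Nonempty V]
        (G : SimpleGraph V) [DecidableRel G.Adj] (k : ℕ),
        3 ≤ k → (∀ K : G.ConnectedComponent, k ≤ K.supp.ncard) →
        (∀ j : ℕ, 3 ≤ j → j < k →
          RSS.mixingTime G j ε ≤
            (⌊C * (j : ℝ) ^ 2 * G.maxDegree * Real.log (Fintype.card V)⌋₊ : ℕ∞)) ∧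
        (∀ (j : ℕ) (hj : 2 ≤ j), j < k → ∀ D : RSS.Run (RSS.State G j),
          (∀ v, D.law v = ENNReal.ofReal (RSS.degreeDist G j v)) →
          ∀ H, (RSS.rejectionLoop G hj D).law H =
            (Fintype.card (RSS.State G (j + 1)) : ENNReal)⁻¹) ∧
        ∀ T : ℕ → ℕ,
          (∀ j : ℕ, 3 ≤ j → j < k →
            (T j : ℕ∞) ≤ max (RSS.mixingTime G j ε) (⌈RSS.explicitSteps G j ε⌉₊ : ℕ∞)) →
          (RSS.uniformSampling G T k).haltProb = 1 ∧
          (RSS.uniformSampling G T k).expectedTime ≤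
            ENNReal.ofReal (C * c ^ (k - 3) * (k ! : ℝ) ^ 2 * ((k - 1)! : ℝ) ^ 2 *
              (G.maxDegree : ℝ) ^ (k - 3) * Real.log (Fintype.card V) ^ (k - 3)) := by
  refine ⟨33, by norm_num, fun ε hε => ?_⟩
  have hM := abs_nonneg (Real.log ε)
  set A : ℝ := (1 + |Real.log ε|) ^ ⌈Real.exp |Real.log ε|⌉₊ with hA
  have hA0 : 0 < A := by positivity
  -- `A` bounds the product of the level factors; the other summands serve the mixing time, the `1`
  -- making up for the rounding down.
  refine ⟨A + 2 * |Real.log ε| + 1, by positivity, ?_⟩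
  intro V _ _ _ G _ k hk hK
  have hΔ : (1 : ℝ) ≤ G.maxDegree := by exact_mod_cast RSS.maxDegree_pos (by omega) hK
  have hL : 1 ≤ Real.log (Fintype.card V) :=
    RSS.one_le_log_of_three_le (by exact_mod_cast hk.trans (RSS.le_card_vertices hK))
  refine ⟨fun j hj hjk => ?_, fun j hj hjk D hD H => ?_, fun T hT => ?_⟩
  · refine RSS.mixingTime_le_of_maxDegree hK (by omega) hjk hε ?_
    refine le_trans ?_ (Nat.sub_one_lt_floor _).le
    have hj3 : (3 : ℝ) ≤ j := by exact_mod_cast hj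
    have hY : 1 ≤ (j : ℝ) ^ 2 * G.maxDegree := by nlinarith
    set Y := (j : ℝ) ^ 2 * G.maxDegree with hYdef
    have hYL : Y ≤ Y * Real.log (Fintype.card V) := le_mul_of_one_le_right (by linarith) hL
    rw [mul_assoc _ ((j : ℝ) ^ 2), mul_assoc _ (_ * _)]
    have h1 : |Real.log ε| * Y ≤ |Real.log ε| * (Y * Real.log (Fintype.card V)) := by gcongr
    have h2 : 0 ≤ A * (Y * Real.log (Fintype.card V)) := by positivity
    linarith
  · have : Nonempty (RSS.State G j) := RSS.nonempty_state hK (by omega) hjk.le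
    exact RSS.law_rejectionLoop hj (RSS.degree_stateGraph_pos hK (by omega) hjk) hD H
  · obtain ⟨i, rfl⟩ : ∃ i, k = i + 3 := ⟨k - 3, by omega⟩
    refine ⟨RSS.haltProb_uniformSampling hk hK T le_rfl, ?_⟩
    refine (RSS.expectedTime_uniformSampling_le hk hK hε hT le_rfl).trans
      (ENNReal.ofReal_le_ofReal ?_)
    have hprod := RSS.prod_levelFactor_le ε i
    rw [RSS.costBound, show i + 3 - 3 = i by omega, show i + 3 - 1 = i + 2 by omega]
    gcongr
    linarith
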